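/- Consider spatially homogeneous spacetimes of Bianchi type VII$_0$, with metric $-dt^2+g_{ab}(t)\,\xi^a\xi^b$, where $\xi^a$ is dual to a left-invariant frame $e_a$ with $[e_a,e_b]=C^d_{ab}e_d$, the only non-vanishing structure constants being $C^2_{31}=-C^2_{13}=1$, $C^3_{12}=-C^3_{21}=1$. Let $f=f(t,p_1,p_2,p_3)\ge 0$ be the distribution function of collisionless particles of unit mass, and set $p^0=\sqrt{1+g^{ab}p_ap_b}$, $$\rho=(\det g)^{-1/2}\!\int f\,p^0\,dp_*,\quad J_i=(\det g)^{-1/2}\!\int f\,p_i\,dp_*,\quad S_{ij}=(\det g)^{-1/2}\!\int f\,\frac{p_ip_j}{p^0}\,dp_*,\quad S=g^{ij}S_{ij}.$$ With $R_{ab}$ the Ricci tensor and $\nabla$ the Levi-Civita connection of $g_{ab}$, $R=g^{ab}R_{ab}$ and $k=g^{ab}k_{ab}$, the Einstein–Vlasov system is $$\dot g_{ab}=2k_{ab},\qquad \dot k_{ab}=-R_{ab}+2k^i_ak_{bi}-k\,k_{ab}+S_{ab}+\tfrac12(\rho-S)g_{ab},$$ $$R-k_{ij}k^{ij}+k^2=2\rho,\qquad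 \nabla^jk_{ji}=-J_i,\qquad p^0\,\partial_tf+C^d_{ba}p^bp_d\,\frac{\partial f}{\partial p_a}=0 .$$ A solution is reflection symmetric if $f(t,p_1,p_2,p_3)=f(t,-p_1,-p_2,p_3)=f(t,p_1,-p_2,-p_3)$ and $g_{ab}$, $k_{ab}$ are diagonal. Let $H=k/3$, $\Sigma^a_b=(k^a_b-H\delta^a_b)/H$, $\Sigma_+=\tfrac12(\Sigma^2_2+\Sigma^3_3)$, $\Sigma_-=\tfrac1{2\sqrt3}(\Sigma^2_2-\Sigma^3_3)$, $N_{22}=H^{-1}\sqrt{g_{22}/(g_{33}g_{11})}$, $N_{33}=H^{-1}\sqrt{g_{33}/(g_{11}g_{22})}$, $N_+=\tfrac12(N_{22}+N_{33})$, $N_-=\tfrac1{2\sqrt3}(N_{22}-N_{33})$, and $$M=\frac1{N_+},\qquad X=\sqrt{N_-^2+\Sigma_-^2},\qquad P(t)=\sup\{g^{ab}p_ap_b : f(t,p_*)\neq0\}.$$ Let $\tau$ be the time variable with $d\tau/dt=H$ and $\tau=\tau_0$ at $t=t_0$. **Proposition.** For every $\epsilon>0$ there is $\delta>0$ such that the following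 holds. Let $t_0,\tau_0\in\mathbb R$, $t_0<T\le\infty$, and let $(g_{ab},k_{ab},f)$ be a reflection symmetric $C^\infty$ solution of the Einstein–Vlasov system with Bianchi VII$_0$ symmetry on $[t_0,T)$ such that, at $t=t_0$, $H>0$, $P<\delta$, $|\Sigma_+|<\delta$, $X<\delta$ and $M<\delta$. Then for all $t\in[t_0,T)$ one has $H>0$, $\rho>0$ and, with $\tau=\tau(t)$, $$|\Sigma_+|\le\epsilon\, e^{(-1+\epsilon)(\tau-\tau_0)},\quad X\le\epsilon\, e^{(-\frac12+\epsilon)(\tau-\tau_0)},\quad M\le\epsilon\, e^{(-\frac12+\epsilon)(\tau-\tau_0)},\quad \frac S\rho\le\epsilon\, e^{(-2+\epsilon)(\tau-\tau_0)} .$$ If $T=\infty$, then $\tau(t)\to\infty$ as $t\to\infty$. -/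

import Mathlib

open Set Filter Topology MeasureTheory
open scoped ContDiff ENNReal

noncomputable section

namespace BianchiEV

/-- `3 × 3` arrays of frame components; the frame indices `1, 2, 3` are the elements
`0, 1, 2` of `Fin 3`. -/
abbrev Mat3 : Type := Matrix (Fin 3) (Fin 3) ℝ

/-- The structure constants of the Lie algebra of Bianchi type VII₀: `structVII0 d a b` is
`C^d_{ab}`, where `[e_a, e_b] = C^d_{ab} e_d`. The non-vanishing ones are
`C^2_{31} = 1 = -C^2_{13}` and `C^3_{12} = 1 = -C^3_{21}`. -/
def structVII0 (d a b : Fin 3) : ℝ :=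
  if (d, a, b) = (1, 2, 0) ∨ (d, a, b) = (2, 0, 1) then 1
  else if (d, a, b) = (1, 0, 2) ∨ (d, a, b) = (2, 1, 0) then -1
  else 0

/-! ### Geometry of the homogeneous slices -/

/-- Connection coefficients of the Levi-Civita connection of the left-invariant metric `g`,
`∇_{e_a} e_b = Γ^c_{ab} e_c` (Koszul formula in a left-invariant frame):
`Γ^c_{ab} = (1/2) g^{cl} (C^m_{ab} g_{ml} - C^m_{bl} g_{ma} + C^m_{la} g_{mb})`. -/
def conn (C : Fin 3 → Fin 3 → Fin 3 → ℝ) (g : Mat3) (c a b : Fin 3) : ℝ :=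
  (1 / 2) * ∑ l, g⁻¹ c l *
    ∑ m, (C m a b * g m l - C m b l * g m a + C m l a * g m b)

/-- The Ricci tensor `R_{ab}` of the left-invariant metric `g`, the trace of the curvature
`∇_X ∇_Y Z - ∇_Y ∇_X Z - ∇_{[X,Y]} Z` over `X`:
`R_{ab} = Γ^m_{ab} Γ^c_{cm} - Γ^m_{cb} Γ^c_{am} - C^m_{ca} Γ^c_{mb}`. -/
def ricci (C : Fin 3 → Fin 3 → Fin 3 → ℝ) (g : Mat3) : Mat3 := Matrix.of fun a b =>
  ∑ c, ∑ m, (conn C g m a b * conn C g c c m - conn C g m c b * conn C g c a m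
    - C m c a * conn C g c m b)

/-- The trace `g^{ab} A_{ab}`; applied to `R_{ab}`, `k_{ab}`, `S_{ab}` it gives `R`, `k`, `S`. -/
def tr (g A : Mat3) : ℝ := ∑ a, ∑ b, g⁻¹ a b * A a b

/-- The mixed components `A^a_b = g^{ac} A_{cb}`. -/
def mixed (g A : Mat3) : Mat3 := g⁻¹ * A

/-- The divergence `∇^j k_{ji}` of a left-invariant covariant two-tensor. -/
def divergence (C : Fin 3 → Fin 3 → Fin 3 → ℝ) (g k : Mat3) (i : Fin 3) : ℝ :=
  ∑ j, ∑ l, g⁻¹ j l * ∑ m, (-(conn C g m l j * k m i) - conn C g m l i * k j m)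

/-! ### Matter quantities of a distribution function `F(p_*)`, `p_* = (p_1, p_2, p_3)` -/

/-- `g^{ab} p_a p_b`. -/
def momSq (g : Mat3) (p : Fin 3 → ℝ) : ℝ := ∑ a, ∑ b, g⁻¹ a b * p a * p b

/-- The particle energy `p^0 = √(1 + g^{ab} p_a p_b)` (unit mass). -/
def energy (g : Mat3) (p : Fin 3 → ℝ) : ℝ := √(1 + momSq g p)

/-- The energy density `ρ = (det g)^{-1/2} ∫ f p^0 dp_*`. -/
def rho (g : Mat3) (F : (Fin 3 → ℝ) → ℝ) : ℝ :=
  (√g.det)⁻¹ * ∫ p, F p * energy g p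

/-- The matter current `J_i = (det g)^{-1/2} ∫ f p_i dp_*`. -/
def current (g : Mat3) (F : (Fin 3 → ℝ) → ℝ) (i : Fin 3) : ℝ :=
  (√g.det)⁻¹ * ∫ p, F p * p i

/-- The spatial stress tensor `S_{ij} = (det g)^{-1/2} ∫ f p_i p_j / p^0 dp_*`. -/
def stress (g : Mat3) (F : (Fin 3 → ℝ) → ℝ) : Mat3 := Matrix.of fun i j =>
  (√g.det)⁻¹ * ∫ p, F p * (p i * p j / energy g p)

/-- `P = sup { g^{ab} p_a p_b | f(p_*) ≠ 0 }`, as an element of `[0, ∞]`. -/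
def momSup (g : Mat3) (F : (Fin 3 → ℝ) → ℝ) : ℝ≥0∞ :=
  ⨆ (p : Fin 3 → ℝ) (_ : F p ≠ 0), ENNReal.ofReal (momSq g p)

/-! ### The Einstein-Vlasov system -/

/-- The time interval `[t₀, T)`, where `T ≤ ∞`. -/
def timeInterval (t₀ : ℝ) (T : EReal) : Set ℝ := {t | t₀ ≤ t ∧ (t : EReal) < T}

/-- `(g, k, f)` is a smooth solution on `[t₀, T)` of the Einstein-Vlasov system for the
spatially homogeneous spacetime `-dt² + g_{ab}(t) ξ^a ξ^b` with structure constants `C`, where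
`k` is the second fundamental form of the slices and `f(t, p_*)` the distribution function. -/
structure IsSolution (C : Fin 3 → Fin 3 → Fin 3 → ℝ) (t₀ : ℝ) (T : EReal)
    (g k : ℝ → Mat3) (f : ℝ → (Fin 3 → ℝ) → ℝ) : Prop where
  smooth_g : ∀ a b, ContDiffOn ℝ ∞ (fun t => g t a b) (timeInterval t₀ T)
  smooth_k : ∀ a b, ContDiffOn ℝ ∞ (fun t => k t a b) (timeInterval t₀ T)
  smooth_f : ContDiffOn ℝ ∞ (fun x : ℝ × (Fin 3 → ℝ) => f x.1 x.2)
    (timeInterval t₀ T ×ˢ (univ : Set (Fin 3 → ℝ)))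
  posDef_g : ∀ t ∈ timeInterval t₀ T, (g t).PosDef
  symm_k : ∀ t ∈ timeInterval t₀ T, (k t).IsSymm
  nonneg_f : ∀ t ∈ timeInterval t₀ T, ∀ p, 0 ≤ f t p
  /-- `ġ_{ab} = 2 k_{ab}` -/
  evol_g : ∀ t ∈ timeInterval t₀ T, ∀ a b,
    HasDerivWithinAt (fun s => g s a b) (2 * k t a b) (timeInterval t₀ T) t
  /-- `k̇_{ab} = -R_{ab} + 2 k^i_a k_{bi} - k k_{ab} + S_{ab} + (1/2) (ρ - S) g_{ab}` -/
  evol_k : ∀ t ∈ timeInterval t₀ T, ∀ a b,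
    HasDerivWithinAt (fun s => k s a b)
      (-(ricci C (g t) a b) + 2 * ∑ i, mixed (g t) (k t) i a * k t b i
        - tr (g t) (k t) * k t a b + stress (g t) (f t) a b
        + (1 / 2) * (rho (g t) (f t) - tr (g t) (stress (g t) (f t))) * g t a b)
      (timeInterval t₀ T) t
  /-- `R - k_{ij} k^{ij} + k² = 2 ρ` -/
  hamiltonian : ∀ t ∈ timeInterval t₀ T,
    tr (g t) (ricci C (g t))
      - ∑ i, ∑ j, mixed (g t) (k t) i j * mixed (g t) (k t) j i
      + tr (g t) (k t) ^ 2 = 2 * rho (g t) (f t)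
  /-- `∇^j k_{ji} = -J_i` -/
  momentum : ∀ t ∈ timeInterval t₀ T, ∀ i,
    divergence C (g t) (k t) i = -current (g t) (f t) i
  /-- `p^0 ∂f/∂t + C^d_{ba} p^b p_d ∂f/∂p_a = 0`, where `p^b = g^{bc} p_c` -/
  vlasov : ∀ t ∈ timeInterval t₀ T, ∀ p : Fin 3 → ℝ,
    energy (g t) p * derivWithin (fun s => f s p) (timeInterval t₀ T) t
      + ∑ a, ∑ b, ∑ d, C d b a * (∑ c, (g t)⁻¹ b c * p c) * p d
          * fderiv ℝ (f t) p (Pi.single a 1) = 0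

/-- Reflection symmetry: `f(t, p_1, p_2, p_3) = f(t, -p_1, -p_2, p_3) = f(t, p_1, -p_2, -p_3)`,
and metric and second fundamental form are invariant under these reflections of the frame, that
is, diagonal. -/
structure IsReflectionSymmetric (t₀ : ℝ) (T : EReal)
    (g k : ℝ → Mat3) (f : ℝ → (Fin 3 → ℝ) → ℝ) : Prop where
  diag_g : ∀ t ∈ timeInterval t₀ T, (g t).IsDiag
  diag_k : ∀ t ∈ timeInterval t₀ T, (k t).IsDiag
  refl_three : ∀ t ∈ timeInterval t₀ T, ∀ p₁ p₂ p₃ : ℝ,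
    f t ![p₁, p₂, p₃] = f t ![-p₁, -p₂, p₃]
  refl_one : ∀ t ∈ timeInterval t₀ T, ∀ p₁ p₂ p₃ : ℝ,
    f t ![p₁, p₂, p₃] = f t ![p₁, -p₂, -p₃]

/-! ### Expansion-normalised variables -/

/-- The Hubble parameter `H = k / 3`. -/
def hubble (g k : Mat3) : ℝ := tr g k / 3

/-- The dimensionless time `τ`, with `dt/dτ = H^{-1}` and `τ(t₀) = τ₀`. -/
def tau (τ₀ t₀ : ℝ) (g k : ℝ → Mat3) (t : ℝ) : ℝ :=
  τ₀ + ∫ s in t₀..t, hubble (g s) (k s)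

/-- `Σ^a_b = σ^a_b / H`, where `σ_{ab} = k_{ab} - H g_{ab}` is the shear. -/
def shear (g k : Mat3) : Mat3 := (hubble g k)⁻¹ • mixed g (k - hubble g k • g)

/-- `Σ₊ = (Σ^2_2 + Σ^3_3) / 2`. -/
def sigmaPlus (g k : Mat3) : ℝ := (shear g k 1 1 + shear g k 2 2) / 2

/-- `Σ₋ = (Σ^2_2 - Σ^3_3) / (2√3)`. -/
def sigmaMinus (g k : Mat3) : ℝ := (shear g k 1 1 - shear g k 2 2) / (2 * √3)

/-- `N_{22} = n_2 / H`, `n_2 = √(g_{22} / (g_{33} g_{11}))`. -/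
def N22 (g k : Mat3) : ℝ := √(g 1 1 / (g 2 2 * g 0 0)) / hubble g k

/-- `N_{33} = n_3 / H`, `n_3 = √(g_{33} / (g_{11} g_{22}))`. -/
def N33 (g k : Mat3) : ℝ := √(g 2 2 / (g 0 0 * g 1 1)) / hubble g k

/-- `N₊ = (N_{22} + N_{33}) / 2`. -/
def Nplus (g k : Mat3) : ℝ := (N22 g k + N33 g k) / 2

/-- `N₋ = (N_{22} - N_{33}) / (2√3)`. -/
def Nminus (g k : Mat3) : ℝ := (N22 g k - N33 g k) / (2 * √3)

/-- `M = 1 / N₊`. -/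
def varM (g k : Mat3) : ℝ := 1 / Nplus g k

/-- The amplitude `X` in `N₋ = X sin ψ`, `Σ₋ = X cos ψ`. -/
def varX (g k : Mat3) : ℝ := √(Nminus g k ^ 2 + sigmaMinus g k ^ 2)

end BianchiEV

end

namespace BianchiEV

/-! The proof is a bootstrap in the expansion-normalised variables `p = Σ₊`, `m = Σ₋`, `n = N₋`, `M
= 1/N₊`, with time `u = τ - τ₀`. Fix a small `η`, take data of size `η ^ 4`, and suppose that all
variables are at most `η` up to some time. The decay estimates below then give bounds strictly below
`η`, so by continuity the assumption never fails.

Matter: while the shear is small, every `2 k^i_i` exceeds `(2 - 7η) H`. The structure-constant term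
leaves `g^{ab} p_a p_b` unchanged, so momenta in the support satisfy `g^{ab} p_a p_b ≤ η ^ 4 e^{(-2
+ 7η)u}` (`IsSolution.momSq_lt_of_ne_zero`). This bounds `S / ρ`, and through `ρ ≤ 3 H²` it bounds
`S / H²`.

Geometry: `M` obeys `M' = -M (1/2 + O(η))`. The pair `(m, n)` rotates with the large frequency `2 /
M`. The rotation drops out of the derivative of `m² + n²`, leaving `-3 m² + n²` to leading order,
which is not negative definite. Adding the corrector `M m n` contributes `2 m² - 2 n²`, so the
corrected energy decays at rate `1 - O(η)` (`corrected_amplitude_rate_le`). This is averaging over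
the rotation. Finally `p` is damped at rate about `3/2`, but it is forced by `-2 n²`, which is only
known to decay like `e^{-u}` up to `O(η)`; hence its rate is about `1`.

Positivity of `H` and divergence of `τ` do not need the bootstrap: `H e^{3u}` is nondecreasing
because the scalar curvature of the slices is nonpositive and `S ≤ ρ`. -/

/-! ### Curvature and kinematics of a diagonal type VII₀ metric. -/

theorem inv_eq_diagonal {g : Mat3} (hg : g.IsDiag) (hpos : ∀ i, 0 < g i i) :
    g⁻¹ = Matrix.diagonal fun i => (g i i)⁻¹ := by
  apply Matrix.inv_eq_right_inv
  rw [← hg.diagonal_diag, Matrix.diagonal_mul_diagonal, ← Matrix.diagonal_one]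
  congr 1
  funext i
  simp [(hpos i).ne']

theorem tr_eq_of_diag {g : Mat3} (hg : g.IsDiag) (hpos : ∀ i, 0 < g i i) (A : Mat3) :
    tr g A = A 0 0 / g 0 0 + A 1 1 / g 1 1 + A 2 2 / g 2 2 := by
  simp [tr, inv_eq_diagonal hg hpos, Fin.sum_univ_three, Matrix.diagonal_apply]
  ring

theorem momSq_eq_of_diag {g : Mat3} (hg : g.IsDiag) (hpos : ∀ i, 0 < g i i) (p : Fin 3 → ℝ) :
    momSq g p = p 0 ^ 2 / g 0 0 + p 1 ^ 2 / g 1 1 + p 2 ^ 2 / g 2 2 := by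
  simp [momSq, inv_eq_diagonal hg hpos, Fin.sum_univ_three, Matrix.diagonal_apply]
  ring

theorem mixed_eq_of_diag {g : Mat3} (hg : g.IsDiag) (hpos : ∀ i, 0 < g i i) (A : Mat3)
    (i j : Fin 3) : mixed g A i j = A i j / g i i := by
  rw [mixed, inv_eq_diagonal hg hpos, Matrix.diagonal_mul]
  ring

theorem ricci_zero_of_diag {g : Mat3} (hg : g.IsDiag) (hpos : ∀ i, 0 < g i i) :
    ricci structVII0 g 0 0 = -(g 1 1 - g 2 2) ^ 2 / (2 * g 1 1 * g 2 2) := by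
  simp [ricci, conn, structVII0, inv_eq_diagonal hg hpos, Fin.sum_univ_three,
    Matrix.diagonal_apply, hg (show (1 : Fin 3) ≠ 0 by decide), hg (show (1 : Fin 3) ≠ 2 by decide),
    hg (show (2 : Fin 3) ≠ 0 by decide), hg (show (2 : Fin 3) ≠ 1 by decide)]
  have := (hpos 0).ne'
  have := (hpos 1).ne'
  have := (hpos 2).ne'
  field_simp
  ring

theorem ricci_one_of_diag {g : Mat3} (hg : g.IsDiag) (hpos : ∀ i, 0 < g i i) :
    ricci structVII0 g 1 1 = (g 1 1 ^ 2 - g 2 2 ^ 2) / (2 * g 0 0 * g 2 2) := by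
  simp [ricci, conn, structVII0, inv_eq_diagonal hg hpos, Fin.sum_univ_three,
    Matrix.diagonal_apply, hg (show (1 : Fin 3) ≠ 0 by decide), hg (show (1 : Fin 3) ≠ 2 by decide),
    hg (show (2 : Fin 3) ≠ 0 by decide), hg (show (2 : Fin 3) ≠ 1 by decide)]
  have := (hpos 0).ne'
  have := (hpos 1).ne'
  have := (hpos 2).ne'
  field_simp
  ring

theorem ricci_two_of_diag {g : Mat3} (hg : g.IsDiag) (hpos : ∀ i, 0 < g i i) :
    ricci structVII0 g 2 2 = (g 2 2 ^ 2 - g 1 1 ^ 2) / (2 * g 0 0 * g 1 1) := by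
  simp [ricci, conn, structVII0, inv_eq_diagonal hg hpos, Fin.sum_univ_three,
    Matrix.diagonal_apply, hg (show (1 : Fin 3) ≠ 0 by decide), hg (show (1 : Fin 3) ≠ 2 by decide),
    hg (show (2 : Fin 3) ≠ 0 by decide), hg (show (2 : Fin 3) ≠ 1 by decide)]
  have := (hpos 0).ne'
  have := (hpos 1).ne'
  have := (hpos 2).ne'
  field_simp
  ring

/-- The mixed diagonal component `k^i_i` (no summation) of the second fundamental form. -/
noncomputable def expRate (g k : Mat3) (i : Fin 3) : ℝ := k i i / g i i

theorem hubble_eq {g : Mat3} (hg : g.IsDiag) (hpos : ∀ i, 0 < g i i) (k : Mat3) :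
    hubble g k = (expRate g k 0 + expRate g k 1 + expRate g k 2) / 3 := by
  rw [hubble, tr_eq_of_diag hg hpos]; rfl

theorem shear_eq {g : Mat3} (hg : g.IsDiag) (hpos : ∀ i, 0 < g i i) (k : Mat3) (i : Fin 3) :
    shear g k i i = (expRate g k i - hubble g k) / hubble g k := by
  have := (hpos i).ne'
  simp only [shear, Matrix.smul_apply, mixed_eq_of_diag hg hpos, Matrix.sub_apply, smul_eq_mul,
    expRate]
  field_simp

theorem sigmaPlus_eq {g : Mat3} (hg : g.IsDiag) (hpos : ∀ i, 0 < g i i) (k : Mat3) :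
    sigmaPlus g k = (expRate g k 1 + expRate g k 2 - 2 * hubble g k) / 2 / hubble g k := by
  rw [sigmaPlus, shear_eq hg hpos, shear_eq hg hpos]; ring

theorem sigmaMinus_eq {g : Mat3} (hg : g.IsDiag) (hpos : ∀ i, 0 < g i i) (k : Mat3) :
    sigmaMinus g k = (expRate g k 1 - expRate g k 2) / (2 * √3) / hubble g k := by
  rw [sigmaMinus, shear_eq hg hpos, shear_eq hg hpos]; ring

/-! ### Evolution of the mixed components and the Hamiltonian constraint. -/

section Evolution

variable {t₀ : ℝ} {T : EReal} {g k : ℝ → Mat3} {f : ℝ → (Fin 3 → ℝ) → ℝ}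

theorem IsSolution.metric_pos {C : Fin 3 → Fin 3 → Fin 3 → ℝ} (h : IsSolution C t₀ T g k f)
    {t : ℝ} (ht : t ∈ timeInterval t₀ T) (i : Fin 3) : 0 < g t i i :=
  (h.posDef_g t ht).diag_pos

/-- For mixed components the term `2 k^i_a k_{bi}` cancels against the derivative of the inverse
metric. What remains is linear in `k^i_i`, apart from the factor `k = 3H`. -/
theorem IsSolution.hasDerivWithinAt_expRate {C : Fin 3 → Fin 3 → Fin 3 → ℝ}
    (h : IsSolution C t₀ T g k f)
    (hr : IsReflectionSymmetric t₀ T g k f) {t : ℝ} (ht : t ∈ timeInterval t₀ T) (i : Fin 3) :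
    HasDerivWithinAt (fun s => expRate (g s) (k s) i)
      (-(ricci C (g t) i i / g t i i) - 3 * hubble (g t) (k t) * expRate (g t) (k t) i
        + stress (g t) (f t) i i / g t i i
        + (rho (g t) (f t) - tr (g t) (stress (g t) (f t))) / 2) (timeInterval t₀ T) t := by
  have hp := h.metric_pos ht
  have hpi := (hp i).ne'
  have hk : ∑ j, mixed (g t) (k t) j i * k t i j = k t i i ^ 2 / g t i i := by
    rw [Finset.sum_eq_single i]
    · rw [mixed_eq_of_diag (hr.diag_g t ht) hp]; ring
    · intro j _ hj
      rw [hr.diag_k t ht (Ne.symm hj), mul_zero]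
    · simp
  have hd := (h.evol_k t ht i i).div (h.evol_g t ht i i) hpi
  refine hd.congr_deriv ?_
  rw [hk, hubble, expRate]
  field_simp
  ring

theorem IsSolution.hamiltonian_eq (h : IsSolution structVII0 t₀ T g k f)
    (hr : IsReflectionSymmetric t₀ T g k f) {t : ℝ} (ht : t ∈ timeInterval t₀ T) :
    2 * rho (g t) (f t) = 9 * hubble (g t) (k t) ^ 2
      - (expRate (g t) (k t) 0 ^ 2 + expRate (g t) (k t) 1 ^ 2 + expRate (g t) (k t) 2 ^ 2)
      - (g t 1 1 - g t 2 2) ^ 2 / (2 * g t 0 0 * g t 1 1 * g t 2 2) := by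
  have hp := h.metric_pos ht
  have hg := hr.diag_g t ht
  have hk := hr.diag_k t ht
  have := (hp 0).ne'
  have := (hp 1).ne'
  have := (hp 2).ne'
  have hH := h.hamiltonian t ht
  rw [← hH, tr_eq_of_diag hg hp, ricci_zero_of_diag hg hp, ricci_one_of_diag hg hp,
    ricci_two_of_diag hg hp, hubble]
  simp [Fin.sum_univ_three, mixed_eq_of_diag hg hp, hk (show (0 : Fin 3) ≠ 1 by decide),
    hk (show (0 : Fin 3) ≠ 2 by decide), hk (show (1 : Fin 3) ≠ 2 by decide),
    hk (show (1 : Fin 3) ≠ 0 by decide), hk (show (2 : Fin 3) ≠ 0 by decide),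
    hk (show (2 : Fin 3) ≠ 1 by decide), expRate]
  field_simp
  ring

theorem IsSolution.hasDerivWithinAt_hubble (h : IsSolution structVII0 t₀ T g k f)
    (hr : IsReflectionSymmetric t₀ T g k f) {t : ℝ} (ht : t ∈ timeInterval t₀ T) :
    HasDerivWithinAt (fun s => hubble (g s) (k s))
      (-3 * hubble (g t) (k t) ^ 2
        + (g t 1 1 - g t 2 2) ^ 2 / (6 * g t 0 0 * g t 1 1 * g t 2 2)
        + rho (g t) (f t) / 2 - tr (g t) (stress (g t) (f t)) / 6) (timeInterval t₀ T) t := by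
  have hp := h.metric_pos ht
  have hg := hr.diag_g t ht
  have := (hp 0).ne'
  have := (hp 1).ne'
  have := (hp 2).ne'
  have hd := (((h.hasDerivWithinAt_expRate hr ht 0).add
    (h.hasDerivWithinAt_expRate hr ht 1)).add (h.hasDerivWithinAt_expRate hr ht 2)).div_const 3
  refine (hd.congr_deriv ?_).congr
    (fun s hs => hubble_eq (hr.diag_g s hs) (h.metric_pos hs) (k s)) (hubble_eq hg hp _)
  rw [ricci_zero_of_diag hg hp, ricci_one_of_diag hg hp,
    ricci_two_of_diag hg hp, tr_eq_of_diag hg hp (stress _ _)]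
  have hH := hubble_eq hg hp (k t)
  have e : expRate (g t) (k t) 0 = 3 * hubble (g t) (k t) - expRate (g t) (k t) 1
    - expRate (g t) (k t) 2 := by linarith
  rw [e]
  field_simp
  ring

end Evolution

/-! ### One-sided derivatives and the time interval. -/

theorem eventually_gt_of_hasDerivWithinAt_neg {φ : ℝ → ℝ} {d a t : ℝ} (hat : a < t)
    (h : HasDerivWithinAt φ d (Icc a t) t) (hd : d < 0) : ∀ᶠ s in 𝓝[<] t, φ t < φ s := by
  have h1 := h.mono Ioo_subset_Icc_self
  rw [hasDerivWithinAt_iff_tendsto_slope' (by simp), nhdsWithin_Ioo_eq_nhdsLT hat] at h1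
  filter_upwards [h1.eventually (gt_mem_nhds hd), self_mem_nhdsWithin] with s hs hst
  rw [slope_def_field, div_neg_iff] at hs
  have : s < t := hst
  rcases hs with hs | hs <;> linarith

section TimeInterval

variable {t₀ t t₁ : ℝ} {T : EReal}

theorem Icc_subset_timeInterval (h : t₁ ∈ timeInterval t₀ T) :
    Icc t₀ t₁ ⊆ timeInterval t₀ T := fun _ hs =>
  ⟨hs.1, lt_of_le_of_lt (EReal.coe_le_coe_iff.2 hs.2) h.2⟩

theorem uniqueDiffOn_timeInterval (h : (t₀ : EReal) < T) :
    UniqueDiffOn ℝ (timeInterval t₀ T) := by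
  obtain ⟨b, hb, hbT⟩ := EReal.lt_iff_exists_real_btwn.1 h
  have hb' : b ∈ timeInterval t₀ T := ⟨(EReal.coe_lt_coe_iff.1 hb).le, hbT⟩
  refine uniqueDiffOn_convex (Set.OrdConnected.convex ⟨fun x hx y hy z hz => ⟨hx.1.trans hz.1,
    lt_of_le_of_lt (EReal.coe_le_coe_iff.2 hz.2) hy.2⟩⟩) ?_
  have h1 : Ioo t₀ b ⊆ interior (timeInterval t₀ T) :=
    interior_maximal (Ioo_subset_Icc_self.trans (Icc_subset_timeInterval hb')) isOpen_Ioo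
  obtain ⟨c, hc⟩ := exists_between (EReal.coe_lt_coe_iff.1 hb)
  exact ⟨c, h1 hc⟩

end TimeInterval

/-! ### The Vlasov equation along tangents to characteristics. -/

section Characteristics

/-- The velocity `dp_a/dt = C^d_{ba} p^b p_d / p^0` of the characteristics of the Vlasov
equation. -/
noncomputable def charVelocity (C : Fin 3 → Fin 3 → Fin 3 → ℝ) (g : Mat3) (p : Fin 3 → ℝ) :
    Fin 3 → ℝ := fun a =>
  (∑ b, ∑ d, C d b a * (∑ c, g⁻¹ b c * p c) * p d) / energy g p

variable {t₀ : ℝ} {T : EReal} {g k : ℝ → Mat3} {f : ℝ → (Fin 3 → ℝ) → ℝ}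
  {C : Fin 3 → Fin 3 → Fin 3 → ℝ}

theorem momSq_nonneg_of_diag {g : Mat3} (hg : g.IsDiag) (hpos : ∀ i, 0 < g i i)
    (p : Fin 3 → ℝ) : 0 ≤ momSq g p := by
  have := hpos 0
  have := hpos 1
  have := hpos 2
  rw [momSq_eq_of_diag hg hpos]
  positivity

theorem one_le_energy_of_diag {g : Mat3} (hg : g.IsDiag) (hpos : ∀ i, 0 < g i i)
    (p : Fin 3 → ℝ) : 1 ≤ energy g p := by
  rw [energy, Real.one_le_sqrt]
  linarith [momSq_nonneg_of_diag hg hpos p]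

theorem sq_energy_of_diag {g : Mat3} (hg : g.IsDiag) (hpos : ∀ i, 0 < g i i)
    (p : Fin 3 → ℝ) : energy g p ^ 2 = 1 + momSq g p :=
  Real.sq_sqrt (by linarith [momSq_nonneg_of_diag hg hpos p])

/-- The Vlasov equation divided by `p^0`, read as a directional derivative. Only the tangent line at
`(t, p)` enters; the maximum principle below needs no more, so the characteristic flow is never
constructed. -/
theorem IsSolution.hasDerivWithinAt_along_characteristic (h : IsSolution C t₀ T g k f)
    (hr : IsReflectionSymmetric t₀ T g k f) {t : ℝ} (ht : t ∈ timeInterval t₀ T)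
    (p : Fin 3 → ℝ) :
    HasDerivWithinAt (fun s => f s (p + (s - t) • charVelocity C (g t) p)) 0
      (timeInterval t₀ T) t := by
  have hT : (t₀ : EReal) < T := lt_of_le_of_lt (EReal.coe_le_coe_iff.2 ht.1) ht.2
  set V := charVelocity C (g t) p with hV
  set I := timeInterval t₀ T
  obtain ⟨L, hL⟩ : DifferentiableWithinAt ℝ (fun x : ℝ × (Fin 3 → ℝ) => f x.1 x.2)
      (I ×ˢ univ) (t, p) := h.smooth_f.differentiableOn (by simp) (t, p) ⟨ht, mem_univ _⟩
  have hline : ∀ v : Fin 3 → ℝ, HasDerivWithinAt (fun s => f s (p + (s - t) • v)) (L (1, v)) I t := by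
    intro v
    have h1 : HasDerivWithinAt (fun s : ℝ => (s, p + (s - t) • v)) ((1 : ℝ), v) I t := by
      refine (hasDerivWithinAt_id t I).prodMk ?_
      have := (((hasDerivWithinAt_id t I).sub_const t).smul_const v).const_add p
      simpa using this
    have h2 : HasFDerivWithinAt (fun x : ℝ × (Fin 3 → ℝ) => f x.1 x.2) L (I ×ˢ univ)
      ((fun s : ℝ => (s, p + (s - t) • v)) t) := by simpa using hL
    have hm : MapsTo (fun s : ℝ => (s, p + (s - t) • v)) I (I ×ˢ univ) :=
      fun s hs => ⟨hs, mem_univ _⟩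
    exact h2.comp_hasDerivWithinAt t h1 hm
  have htime : derivWithin (fun s => f s p) I t = L (1, 0) := by
    have := hline 0
    simp only [smul_zero, add_zero] at this
    exact this.derivWithin (uniqueDiffOn_timeInterval hT t ht)
  have hspace : fderiv ℝ (f t) p = L.comp (ContinuousLinearMap.inr ℝ ℝ (Fin 3 → ℝ)) := by
    have h1 : HasFDerivWithinAt (fun q : Fin 3 → ℝ => (t, q))
        (ContinuousLinearMap.inr ℝ ℝ (Fin 3 → ℝ)) univ p :=
      (hasFDerivAt_prodMk_right t p).hasFDerivWithinAt
    have := HasFDerivWithinAt.comp p (g := fun x : ℝ × (Fin 3 → ℝ) => f x.1 x.2) hL h1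
      (fun q _ => ⟨ht, mem_univ _⟩)
    exact (hasFDerivWithinAt_univ.1 this).fderiv
  have hv := h.vlasov t ht p
  have hE : energy (g t) p ≠ 0 :=
    (lt_of_lt_of_le one_pos (one_le_energy_of_diag (hr.diag_g t ht) (h.metric_pos ht) p)).ne'
  convert hline V using 1
  have hsum : L (0, V) = ∑ a, V a * L (0, Pi.single a 1) := by
    have := (L.comp (ContinuousLinearMap.inr ℝ ℝ (Fin 3 → ℝ))).toLinearMap.pi_apply_eq_sum_univ V
    simp only [ContinuousLinearMap.coe_coe, ContinuousLinearMap.comp_apply,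
      ContinuousLinearMap.inr_apply, smul_eq_mul] at this
    rw [this]
    refine Finset.sum_congr rfl fun a _ => ?_
    congr 3
    ext j
    simp [Pi.single_apply, eq_comm]
  have hsplit : L (1, V) = L (1, 0) + L (0, V) := by rw [← map_add]; simp
  rw [hsplit, hsum]
  rw [htime, hspace] at hv
  have hv' : energy (g t) p * (L (1, 0) + ∑ a, V a * L (0, Pi.single a 1)) = 0 := by
    refine Eq.trans ?_ hv
    rw [mul_add, Finset.mul_sum]
    congr 1
    refine Finset.sum_congr rfl fun a _ => ?_
    simp only [ContinuousLinearMap.comp_apply, ContinuousLinearMap.inr_apply, hV, charVelocity,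
      ← Finset.sum_mul]
    field_simp
  exact ((mul_eq_zero.1 hv').resolve_left hE).symm

theorem IsSolution.hasDerivWithinAt_momSq_along_characteristic
    (h : IsSolution structVII0 t₀ T g k f)
    (hr : IsReflectionSymmetric t₀ T g k f) {t : ℝ} (ht : t ∈ timeInterval t₀ T)
    (p : Fin 3 → ℝ) :
    HasDerivWithinAt (fun s => momSq (g s) (p + (s - t) • charVelocity structVII0 (g t) p))
      (-2 * (expRate (g t) (k t) 0 * (p 0 ^ 2 / g t 0 0) + expRate (g t) (k t) 1
        * (p 1 ^ 2 / g t 1 1) + expRate (g t) (k t) 2 * (p 2 ^ 2 / g t 2 2)))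
      (timeInterval t₀ T) t := by
  have hp := h.metric_pos ht
  have hg := hr.diag_g t ht
  have hE : energy (g t) p ≠ 0 :=
    (lt_of_lt_of_le one_pos (one_le_energy_of_diag hg hp p)).ne'
  set V := charVelocity structVII0 (g t) p with hV
  have hterm : ∀ i, HasDerivWithinAt (fun s => (p i + (s - t) * V i) ^ 2 / g s i i)
      (2 * p i * V i / g t i i - 2 * (expRate (g t) (k t) i * (p i ^ 2 / g t i i)))
      (timeInterval t₀ T) t := by
    intro i
    have h1 := ((((hasDerivWithinAt_id t (timeInterval t₀ T)).sub_const t).mul_const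
      (V i)).const_add (p i)).pow 2
    have hi := (hp i).ne'
    refine (h1.div (h.evol_g t ht i i) hi).congr_deriv ?_
    simp [expRate]
    field_simp
  have h1 := ((hterm 0).add (hterm 1)).add (hterm 2)
  refine (h1.congr_deriv ?_).congr (fun s hs => ?_) ?_
  · have := (hp 0).ne'
    have := (hp 1).ne'
    have := (hp 2).ne'
    -- The velocity is orthogonal to `p`, by antisymmetry of `C^d_{ba}` against `p^b p^a`. Hence
    -- only the change of the metric alters `g^{ab} p_a p_b`.
    have hort : p 0 * V 0 / g t 0 0 + p 1 * V 1 / g t 1 1 + p 2 * V 2 / g t 2 2 = 0 := by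
      simp [hV, charVelocity, structVII0, inv_eq_diagonal hg hp, Fin.sum_univ_three,
        Matrix.diagonal_apply]
      field_simp
      ring
    linear_combination 2 * hort
  · rw [momSq_eq_of_diag (hr.diag_g s hs) (h.metric_pos hs)]
    simp
  · rw [momSq_eq_of_diag hg hp]
    simp

end Characteristics

/-! ### Momentum bounds on the support of the distribution function. -/

section Support

variable {t₀ : ℝ} {T : EReal} {g k : ℝ → Mat3} {f : ℝ → (Fin 3 → ℝ) → ℝ}

theorem continuousOn_momSq_of_diag {I : Set ℝ} (hc : ∀ i, ContinuousOn (fun t => g t i i) I)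
    (hg : ∀ t ∈ I, (g t).IsDiag) (hp : ∀ t ∈ I, ∀ i, 0 < g t i i) :
    ContinuousOn (fun x : ℝ × (Fin 3 → ℝ) => momSq (g x.1) x.2) (I ×ˢ univ) := by
  have hterm : ∀ i, ContinuousOn (fun x : ℝ × (Fin 3 → ℝ) => x.2 i ^ 2 / g x.1 i i)
      (I ×ˢ univ) := by
    intro i
    refine ContinuousOn.div (by fun_prop) ((hc i).comp continuousOn_fst fun x hx => hx.1) ?_
    exact fun x hx => (hp x.1 hx.1 i).ne'
  exact (((hterm 0).add (hterm 1)).add (hterm 2)).congr fun x hx =>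
    momSq_eq_of_diag (hg x.1 hx.1) (hp x.1 hx.1) x.2

theorem IsSolution.continuousOn_metric {C : Fin 3 → Fin 3 → Fin 3 → ℝ}
    (h : IsSolution C t₀ T g k f) (i j : Fin 3) :
    ContinuousOn (fun t => g t i j) (timeInterval t₀ T) := (h.smooth_g i j).continuousOn

theorem IsSolution.continuousOn_expRate {C : Fin 3 → Fin 3 → Fin 3 → ℝ}
    (h : IsSolution C t₀ T g k f) (i : Fin 3) :
    ContinuousOn (fun t => expRate (g t) (k t) i) (timeInterval t₀ T) :=
  (h.smooth_k i i).continuousOn.div (h.smooth_g i i).continuousOn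
    fun _ ht => (h.metric_pos ht i).ne'

theorem sq_le_of_momSq_le {g : Mat3} (hg : g.IsDiag) (hpos : ∀ i, 0 < g i i) {p : Fin 3 → ℝ}
    {A : ℝ} (h : momSq g p ≤ A) (i : Fin 3) : p i ^ 2 ≤ A * g i i := by
  rw [momSq_eq_of_diag hg hpos] at h
  have h0 : 0 ≤ p 0 ^ 2 / g 0 0 := div_nonneg (sq_nonneg _) (hpos 0).le
  have h1 : 0 ≤ p 1 ^ 2 / g 1 1 := div_nonneg (sq_nonneg _) (hpos 1).le
  have h2 : 0 ≤ p 2 ^ 2 / g 2 2 := div_nonneg (sq_nonneg _) (hpos 2).le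
  rw [← div_le_iff₀ (hpos i)]
  fin_cases i <;> simp <;> linarith

/-- The derivative of `g^{ab} p_a p_b e^a` along the tangent line of a characteristic. -/
theorem IsSolution.hasDerivWithinAt_weighted_momSq (h : IsSolution structVII0 t₀ T g k f)
    (hr : IsReflectionSymmetric t₀ T g k f) {t : ℝ} (ht : t ∈ timeInterval t₀ T)
    (p : Fin 3 → ℝ) {a : ℝ → ℝ} {a' : ℝ} {J : Set ℝ} (hJ : J ⊆ timeInterval t₀ T)
    (ha : HasDerivWithinAt a a' J t) :
    HasDerivWithinAt (fun s => momSq (g s) (p + (s - t) • charVelocity structVII0 (g t) p)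
        * Real.exp (a s))
      (((a' - 2 * expRate (g t) (k t) 0) * (p 0 ^ 2 / g t 0 0)
        + (a' - 2 * expRate (g t) (k t) 1) * (p 1 ^ 2 / g t 1 1)
        + (a' - 2 * expRate (g t) (k t) 2) * (p 2 ^ 2 / g t 2 2)) * Real.exp (a t)) J t := by
  refine (((h.hasDerivWithinAt_momSq_along_characteristic hr ht p).mono hJ).mul
    ha.exp).congr_deriv ?_
  simp only [sub_self, zero_smul, add_zero]
  rw [momSq_eq_of_diag (hr.diag_g t ht) (h.metric_pos ht)]
  ring

/-- Propagation of momentum bounds on the support of `f`, by a maximum principle for the Vlasov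
equation on a compact region which characteristics followed backwards in time do not leave. -/
theorem IsSolution.momSq_lt_of_ne_zero (h : IsSolution structVII0 t₀ T g k f)
    (hr : IsReflectionSymmetric t₀ T g k f) {t₁ : ℝ} (ht₁ : t₁ ∈ timeInterval t₀ T)
    {a a' : ℝ → ℝ} (ha : ∀ t ∈ Icc t₀ t₁, HasDerivWithinAt a (a' t) (Icc t₀ t₁) t)
    (ha0 : a t₀ = 0)
    (hlt : ∀ t ∈ Icc t₀ t₁, ∀ i, a' t < 2 * expRate (g t) (k t) i)
    {δ : ℝ} (hδ : 0 < δ) (hinit : ∀ p, δ ≤ momSq (g t₀) p → f t₀ p = 0)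
    {q : Fin 3 → ℝ} (hq : f t₁ q ≠ 0) : momSq (g t₁) q * Real.exp (a t₁) < δ := by
  by_contra! hcon
  have hJ := Icc_subset_timeInterval ht₁
  have hfq : 0 < f t₁ q := lt_of_le_of_ne (h.nonneg_f t₁ ht₁ q) (Ne.symm hq)
  have h01 : t₀ < t₁ := by
    refine lt_of_le_of_ne ht₁.1 fun e => hq ?_
    subst e
    exact hinit q (by simpa [ha0] using hcon)
  obtain ⟨L, hL⟩ : ∃ L : ℝ, ∀ t ∈ Icc t₀ t₁, ∀ i, 2 * expRate (g t) (k t) i < L := by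
    have hb : ∀ i, ∃ B : ℝ, ∀ t ∈ Icc t₀ t₁, expRate (g t) (k t) i ≤ B := fun i => by
      obtain ⟨B, hB⟩ := isCompact_Icc.exists_bound_of_continuousOn
        ((h.continuousOn_expRate i).mono hJ)
      exact ⟨B, fun t ht => (le_abs_self _).trans (hB t ht)⟩
    choose B hB using hb
    refine ⟨2 * (|B 0| + |B 1| + |B 2|) + 1, fun t ht i => ?_⟩
    have h1 := hB i t ht
    have := abs_nonneg (B 0)
    have := abs_nonneg (B 1)
    have := abs_nonneg (B 2)
    have : B i ≤ |B 0| + |B 1| + |B 2| := by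
      refine (le_abs_self _).trans ?_
      fin_cases i <;> simp <;> linarith
    linarith
  -- Since `L` exceeds every `2 k^i_i`, the weight `exp b` makes the momentum norm decrease
  -- backwards in time. It serves only to keep the region below bounded.
  set b : ℝ → ℝ := fun t => L * (t - t₀) with hb
  have hbd : ∀ t, HasDerivWithinAt b L (Icc t₀ t₁) t := fun t => by
    simpa using ((hasDerivWithinAt_id t (Icc t₀ t₁)).sub_const t₀).const_mul L
  set Φ : ℝ × (Fin 3 → ℝ) → ℝ := fun x => momSq (g x.1) x.2 * Real.exp (a x.1) with hΦ
  set Ψ : ℝ × (Fin 3 → ℝ) → ℝ := fun x => momSq (g x.1) x.2 * Real.exp (b x.1) with hΨ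
  set A := Ψ (t₁, q) with hA
  set D : Set (ℝ × (Fin 3 → ℝ)) := Icc t₀ t₁ ×ˢ univ with hD
  have hDc : IsClosed D := isClosed_Icc.prod isClosed_univ
  have hQ : ContinuousOn (fun x : ℝ × (Fin 3 → ℝ) => momSq (g x.1) x.2) D :=
    continuousOn_momSq_of_diag (fun i => (h.continuousOn_metric i i).mono hJ)
      (fun t ht => hr.diag_g t (hJ ht)) (fun t ht => h.metric_pos (hJ ht))
  have hac : ContinuousOn a (Icc t₀ t₁) := fun t ht => (ha t ht).continuousWithinAt
  have hbc : ContinuousOn b (Icc t₀ t₁) := fun t _ => (hbd t).continuousWithinAt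
  have hΦc : ContinuousOn Φ D :=
    hQ.mul (Real.continuous_exp.comp_continuousOn (hac.comp continuousOn_fst fun x hx => hx.1))
  have hΨc : ContinuousOn Ψ D :=
    hQ.mul (Real.continuous_exp.comp_continuousOn (hbc.comp continuousOn_fst fun x hx => hx.1))
  -- Following characteristics backwards raises `Φ` and lowers `Ψ`, so neither of the two
  -- constraints can be violated.
  set K : Set (ℝ × (Fin 3 → ℝ)) := (D ∩ Φ ⁻¹' Ici δ) ∩ (D ∩ Ψ ⁻¹' Iic A) with hK
  have hKc : IsClosed K := (hΦc.preimage_isClosed_of_isClosed hDc isClosed_Ici).inter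
    (hΨc.preimage_isClosed_of_isClosed hDc isClosed_Iic)
  have hKb : IsCompact K := by
    obtain ⟨G, hG⟩ : ∃ G : ℝ, ∀ t ∈ Icc t₀ t₁, ∀ i, g t i i ≤ G := by
      have hb : ∀ i, ∃ B : ℝ, ∀ t ∈ Icc t₀ t₁, g t i i ≤ B := fun i => by
        obtain ⟨B, hB⟩ := isCompact_Icc.exists_bound_of_continuousOn
          ((h.continuousOn_metric i i).mono hJ)
        exact ⟨B, fun t ht => (le_abs_self _).trans (hB t ht)⟩
      choose B hB using hb
      refine ⟨max (B 0) (max (B 1) (B 2)), fun t ht i => (hB i t ht).trans ?_⟩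
      fin_cases i <;> simp
    obtain ⟨E, hE⟩ : ∃ E : ℝ, ∀ t ∈ Icc t₀ t₁, Real.exp (-b t) ≤ E := by
      obtain ⟨B, hB⟩ := isCompact_Icc.exists_bound_of_continuousOn
        (Real.continuous_exp.comp_continuousOn hbc.neg)
      exact ⟨B, fun t ht => (le_abs_self _).trans (hB t ht)⟩
    have hA0 : 0 ≤ A := mul_nonneg (momSq_nonneg_of_diag (hr.diag_g t₁ ht₁) (h.metric_pos ht₁) q)
      (Real.exp_pos _).le
    refine IsCompact.of_isClosed_subset
      ((isCompact_Icc (a := t₀) (b := t₁)).prod (isCompact_closedBall (0 : Fin 3 → ℝ) (√(A * E * G)))) hKc ?_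
    rintro ⟨t, p⟩ hx
    have ht : t ∈ Icc t₀ t₁ := hx.1.1.1
    have h1 : momSq (g t) p ≤ A * E := by
      have h2 : momSq (g t) p * Real.exp (b t) ≤ A := hx.2.2
      have h3 : momSq (g t) p = momSq (g t) p * Real.exp (b t) * Real.exp (-b t) := by
        rw [mul_assoc, ← Real.exp_add]; simp
      rw [h3]
      exact mul_le_mul h2 (hE t ht) (Real.exp_pos _).le hA0
    refine ⟨ht, ?_⟩
    rw [mem_closedBall_zero_iff, pi_norm_le_iff_of_nonneg (Real.sqrt_nonneg _)]
    intro i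
    refine Real.abs_le_sqrt ((sq_le_of_momSq_le (hr.diag_g t (hJ ht)) (h.metric_pos (hJ ht))
      h1 i).trans (mul_le_mul_of_nonneg_left (hG t ht i) ?_))
    exact (momSq_nonneg_of_diag (hr.diag_g t (hJ ht)) (h.metric_pos (hJ ht)) p).trans h1
  -- With this slope the penalised function `f - c (t - t₀)` still equals `f t₁ q / 2 > 0` at `(t₁,
  -- q)`. At `t₀` it vanishes on `K`, so its maximum is attained at a time after `t₀`.
  set c := f t₁ q / (2 * (t₁ - t₀)) with hc
  have h01' : 0 < t₁ - t₀ := sub_pos.2 h01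
  have hc0 : 0 < c := by positivity
  have hqK : (t₁, q) ∈ K := ⟨⟨⟨⟨h01.le, le_rfl⟩, mem_univ _⟩, hcon⟩, ⟨⟨h01.le, le_rfl⟩, mem_univ _⟩,
    le_refl A⟩
  have hwc : ContinuousOn (fun x : ℝ × (Fin 3 → ℝ) => f x.1 x.2 - c * (x.1 - t₀)) K := by
    refine ContinuousOn.sub (h.smooth_f.continuousOn.mono ?_) (by fun_prop)
    exact fun x hx => ⟨hJ hx.1.1.1, mem_univ _⟩
  obtain ⟨⟨t, p⟩, hx, hmax⟩ := hKb.exists_isMaxOn ⟨_, hqK⟩ hwc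
  have ht : t ∈ Icc t₀ t₁ := hx.1.1.1
  have hmax1 : f t₁ q - c * (t₁ - t₀) ≤ f t p - c * (t - t₀) := hmax hqK
  have hct : c * (t₁ - t₀) = f t₁ q / 2 := by rw [hc]; field_simp
  have htt : t₀ < t := by
    refine lt_of_le_of_ne ht.1 fun e => ?_
    have h1 : δ ≤ momSq (g t) p * Real.exp (a t) := hx.1.2
    rw [← e, ha0, Real.exp_zero, mul_one] at h1
    rw [← e, hinit p h1] at hmax1
    linarith
  have hJt : Icc t₀ t ⊆ Icc t₀ t₁ := Icc_subset_Icc_right ht.2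
  have hposQ : 0 < momSq (g t) p := by
    have h1 : δ ≤ momSq (g t) p * Real.exp (a t) := hx.1.2
    exact pos_of_mul_pos_left (hδ.trans_le h1) (Real.exp_pos _).le
  have hg := hr.diag_g t (hJ ht)
  have hp := h.metric_pos (hJ ht)
  have hcomb : ∀ r : Fin 3 → ℝ, (∀ i, r i < 0) → r 0 * (p 0 ^ 2 / g t 0 0)
      + r 1 * (p 1 ^ 2 / g t 1 1) + r 2 * (p 2 ^ 2 / g t 2 2) < 0 := by
    intro r hneg
    rw [momSq_eq_of_diag hg hp] at hposQ
    have e0 : 0 ≤ p 0 ^ 2 / g t 0 0 := div_nonneg (sq_nonneg _) (hp 0).le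
    have e1 : 0 ≤ p 1 ^ 2 / g t 1 1 := div_nonneg (sq_nonneg _) (hp 1).le
    have e2 : 0 ≤ p 2 ^ 2 / g t 2 2 := div_nonneg (sq_nonneg _) (hp 2).le
    by_contra! hge
    have m0 := mul_nonneg (neg_nonneg.2 (hneg 0).le) e0
    have m1 := mul_nonneg (neg_nonneg.2 (hneg 1).le) e1
    have m2 := mul_nonneg (neg_nonneg.2 (hneg 2).le) e2
    have z0 : p 0 ^ 2 / g t 0 0 = 0 :=
      (mul_eq_zero.1 (show r 0 * (p 0 ^ 2 / g t 0 0) = 0 by linarith)).resolve_left (hneg 0).ne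
    have z1 : p 1 ^ 2 / g t 1 1 = 0 :=
      (mul_eq_zero.1 (show r 1 * (p 1 ^ 2 / g t 1 1) = 0 by linarith)).resolve_left (hneg 1).ne
    have z2 : p 2 ^ 2 / g t 2 2 = 0 :=
      (mul_eq_zero.1 (show r 2 * (p 2 ^ 2 / g t 2 2) = 0 by linarith)).resolve_left (hneg 2).ne
    linarith
  set V := charVelocity structVII0 (g t) p with hV
  have hdΦ := eventually_gt_of_hasDerivWithinAt_neg htt
    (h.hasDerivWithinAt_weighted_momSq hr (hJ ht) p (hJt.trans hJ) ((ha t ht).mono hJt))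
    (mul_neg_of_neg_of_pos (hcomb (fun i => a' t - 2 * expRate (g t) (k t) i)
      fun i => sub_neg.2 (hlt t ht i)) (Real.exp_pos _))
  have hdΨ := eventually_gt_of_hasDerivWithinAt_neg htt
    (h.hasDerivWithinAt_weighted_momSq hr (hJ ht) p (hJt.trans hJ) ((hbd t).mono hJt)).neg
    (by
      have := mul_neg_of_neg_of_pos (hcomb (fun i => -(L - 2 * expRate (g t) (k t) i))
        fun i => neg_lt_zero.2 (sub_pos.2 (hL t ht i))) (Real.exp_pos (b t))
      linarith)
  -- Along the tangent `f` is stationary, so the penalised function has slope `-c < 0`. A short step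
  -- backwards stays in `K` and beats the maximum.
  have hdw := eventually_gt_of_hasDerivWithinAt_neg htt
    (((h.hasDerivWithinAt_along_characteristic hr (hJ ht) p).mono (hJt.trans hJ)).sub
      (((hasDerivWithinAt_id t (Icc t₀ t)).sub_const t₀).const_mul c)) (by linarith)
  have hIoo : ∀ᶠ s in 𝓝[<] t, s ∈ Ioo t₀ t := Ioo_mem_nhdsLT htt
  obtain ⟨s, hsΦ, hsΨ, hsw, hs⟩ := (hdΦ.and (hdΨ.and (hdw.and hIoo))).exists
  have hs' : s ∈ Icc t₀ t₁ := ⟨hs.1.le, hs.2.le.trans ht.2⟩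
  simp only [sub_self, zero_smul, add_zero, Pi.neg_apply, neg_lt_neg_iff, Pi.sub_apply, id_eq]
    at hsΦ hsΨ hsw
  have hsK : (s, p + (s - t) • V) ∈ K :=
    ⟨⟨⟨hs', mem_univ _⟩, le_trans (show δ ≤ momSq (g t) p * Real.exp (a t) from hx.1.2) hsΦ.le⟩,
      ⟨hs', mem_univ _⟩, hsΨ.le.trans (show momSq (g t) p * Real.exp (b t) ≤ A from hx.2.2)⟩
  exact absurd hsw (not_lt.2 (hmax hsK))

end Support

/-! ### Comparison of `S` with `ρ`. -/

section Matter

variable {g : Mat3} {F : (Fin 3 → ℝ) → ℝ} {A : ℝ}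

theorem continuous_momSq (g : Mat3) : Continuous (momSq g) := by
  unfold momSq; fun_prop

theorem continuous_energy (g : Mat3) : Continuous (energy g) :=
  (continuous_const.add (continuous_momSq g)).sqrt

theorem hasCompactSupport_of_momSq_le (hg : g.IsDiag) (hpos : ∀ i, 0 < g i i)
    (hA : ∀ p, F p ≠ 0 → momSq g p ≤ A) : HasCompactSupport F := by
  refine HasCompactSupport.of_support_subset_isCompact
    (isCompact_closedBall (0 : Fin 3 → ℝ) (√(A * g 0 0) + √(A * g 1 1) + √(A * g 2 2))) ?_
  intro p hp
  have h0 := Real.sqrt_nonneg (A * g 0 0)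
  have h1 := Real.sqrt_nonneg (A * g 1 1)
  have h2 := Real.sqrt_nonneg (A * g 2 2)
  rw [mem_closedBall_zero_iff, pi_norm_le_iff_of_nonneg (by positivity)]
  intro i
  refine (Real.abs_le_sqrt (sq_le_of_momSq_le hg hpos (hA p hp) i)).trans ?_
  fin_cases i <;> simp <;> linarith

theorem rho_nonneg (hF0 : ∀ p, 0 ≤ F p) : 0 ≤ rho g F :=
  mul_nonneg (inv_nonneg.2 (Real.sqrt_nonneg _))
    (integral_nonneg fun p => mul_nonneg (hF0 p) (Real.sqrt_nonneg _))

theorem stress_diag_nonneg (hF0 : ∀ p, 0 ≤ F p) (i : Fin 3) : 0 ≤ stress g F i i :=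
  mul_nonneg (inv_nonneg.2 (Real.sqrt_nonneg _))
    (integral_nonneg fun p => mul_nonneg (hF0 p)
      (div_nonneg (mul_self_nonneg _) (Real.sqrt_nonneg _)))

theorem tr_stress_eq (hg : g.IsDiag) (hpos : ∀ i, 0 < g i i) (hFc : Continuous F)
    (hA : ∀ p, F p ≠ 0 → momSq g p ≤ A) :
    tr g (stress g F) = (√g.det)⁻¹ * ∫ p, F p * (momSq g p / energy g p) := by
  have hE : ∀ p, energy g p ≠ 0 := fun p =>
    (lt_of_lt_of_le one_pos (one_le_energy_of_diag hg hpos p)).ne'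
  have hint : ∀ i, Integrable fun p => F p * (p i * p i / energy g p) / g i i := fun i =>
    Continuous.integrable_of_hasCompactSupport
      ((hFc.mul (Continuous.div (by fun_prop) (continuous_energy g) hE)).div_const _)
      (by
        have := (hasCompactSupport_of_momSq_le hg hpos hA).mul_right
          (f' := fun p => p i * p i / energy g p / g i i)
        have e : (fun p => F p * (p i * p i / energy g p) / g i i)
            = F * fun p => p i * p i / energy g p / g i i := funext fun p => mul_div_assoc _ _ _
        rw [e]
        exact this)
  have hsplit : ∫ p, F p * (momSq g p / energy g p) = (∫ p, F p * (p 0 * p 0 / energy g p) / g 0 0)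
      + (∫ p, F p * (p 1 * p 1 / energy g p) / g 1 1)
      + ∫ p, F p * (p 2 * p 2 / energy g p) / g 2 2 := by
    rw [← integral_add (hint 0) (hint 1)]
    refine Eq.trans ?_ (integral_add ((hint 0).add (hint 1)) (hint 2))
    refine integral_congr_ae (Eventually.of_forall fun p => ?_)
    simp only [momSq_eq_of_diag hg hpos]
    ring
  rw [tr_eq_of_diag hg hpos, hsplit]
  simp only [stress, Matrix.of_apply, integral_div]
  ring

/-- The integrands are compared pointwise on the support. The bound `A` serves only to make the
support compact and hence the integrals convergent. -/
theorem tr_stress_le_rho (hg : g.IsDiag) (hpos : ∀ i, 0 < g i i) (hFc : Continuous F)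
    (hF0 : ∀ p, 0 ≤ F p) (hA : ∀ p, F p ≠ 0 → momSq g p ≤ A) {c : ℝ}
    (hc : ∀ p, F p ≠ 0 → momSq g p / energy g p ≤ c * energy g p) :
    tr g (stress g F) ≤ c * rho g F := by
  have hE : ∀ p, energy g p ≠ 0 := fun p =>
    (lt_of_lt_of_le one_pos (one_le_energy_of_diag hg hpos p)).ne'
  have hsupp := hasCompactSupport_of_momSq_le hg hpos hA
  rw [tr_stress_eq hg hpos hFc hA, rho, mul_left_comm, ← integral_const_mul c]
  refine mul_le_mul_of_nonneg_left (integral_mono ?_ ?_ fun p => ?_)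
    (inv_nonneg.2 (Real.sqrt_nonneg _))
  · exact Continuous.integrable_of_hasCompactSupport
      (hFc.mul ((continuous_momSq g).div (continuous_energy g) hE)) hsupp.mul_right
  · exact (Continuous.integrable_of_hasCompactSupport
      (hFc.mul (continuous_energy g)) hsupp.mul_right).const_mul c
  · by_cases hp : F p = 0
    · simp [hp]
    · have := mul_le_mul_of_nonneg_left (hc p hp) (hF0 p)
      linarith

theorem tr_stress_le_mul_rho (hg : g.IsDiag) (hpos : ∀ i, 0 < g i i) (hFc : Continuous F)
    (hF0 : ∀ p, 0 ≤ F p) (hA0 : 0 ≤ A) (hA : ∀ p, F p ≠ 0 → momSq g p ≤ A) :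
    tr g (stress g F) ≤ A * rho g F := by
  refine tr_stress_le_rho hg hpos hFc hF0 hA fun p hp => ?_
  have h1 := one_le_energy_of_diag hg hpos p
  rw [div_le_iff₀ (by linarith)]
  have := hA p hp
  -- The chain is `g^{ab} p_a p_b ≤ A ≤ A (p^0)²`, since `p^0 ≥ 1`.
  nlinarith [mul_nonneg hA0 (sub_nonneg.2 h1), mul_nonneg hA0 (mul_nonneg (sub_nonneg.2 h1) (sub_nonneg.2 h1))]

theorem tr_stress_le_self_rho (hg : g.IsDiag) (hpos : ∀ i, 0 < g i i) (hFc : Continuous F)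
    (hF0 : ∀ p, 0 ≤ F p) (hA : ∀ p, F p ≠ 0 → momSq g p ≤ A) :
    tr g (stress g F) ≤ rho g F := by
  rw [← one_mul (rho g F)]
  refine tr_stress_le_rho hg hpos hFc hF0 hA fun p _ => ?_
  have h1 := one_le_energy_of_diag hg hpos p
  rw [div_le_iff₀ (by linarith)]
  nlinarith [sq_energy_of_diag hg hpos p]

end Matter

/-! ### A priori compactness of the momentum support. -/

section Global

variable {t₀ : ℝ} {T : EReal} {g k : ℝ → Mat3} {f : ℝ → (Fin 3 → ℝ) → ℝ}

theorem eq_zero_of_le_momSq {g : Mat3} {F : (Fin 3 → ℝ) → ℝ} {δ : ℝ}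
    (h : momSup g F < ENNReal.ofReal δ) (p : Fin 3 → ℝ) (hp : δ ≤ momSq g p) : F p = 0 := by
  by_contra hF
  have h1 : ENNReal.ofReal (momSq g p) ≤ momSup g F :=
    le_iSup₂ (f := fun (q : Fin 3 → ℝ) (_ : F q ≠ 0) => ENNReal.ofReal (momSq g q)) p hF
  exact absurd (ENNReal.ofReal_le_ofReal hp) (not_le.2 (h1.trans_lt h))

theorem IsSolution.continuous_distribution {C : Fin 3 → Fin 3 → Fin 3 → ℝ}
    (h : IsSolution C t₀ T g k f) {t : ℝ} (ht : t ∈ timeInterval t₀ T) : Continuous (f t) := by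
  rw [← continuousOn_univ]
  exact h.smooth_f.continuousOn.comp (f := fun p : Fin 3 → ℝ => (t, p)) (by fun_prop)
    fun p _ => ⟨ht, mem_univ p⟩

/-- A crude bound, with a constant depending on `t` and on the solution. It makes the matter
integrals tractable before any smallness is known, as the sign of `H` requires. -/
theorem IsSolution.exists_momSq_le (h : IsSolution structVII0 t₀ T g k f)
    (hr : IsReflectionSymmetric t₀ T g k f) {δ : ℝ} (hδ : 0 < δ)
    (hinit : ∀ p, δ ≤ momSq (g t₀) p → f t₀ p = 0) {t : ℝ} (ht : t ∈ timeInterval t₀ T) :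
    ∃ A : ℝ, ∀ p, f t p ≠ 0 → momSq (g t) p ≤ A := by
  have hJ := Icc_subset_timeInterval ht
  obtain ⟨L, hL⟩ : ∃ L : ℝ, ∀ s ∈ Icc t₀ t, ∀ i, L < 2 * expRate (g s) (k s) i := by
    have hb : ∀ i, ∃ B : ℝ, ∀ s ∈ Icc t₀ t, |expRate (g s) (k s) i| ≤ B := fun i =>
      isCompact_Icc.exists_bound_of_continuousOn ((h.continuousOn_expRate i).mono hJ)
    choose B hB using hb
    refine ⟨-(2 * (|B 0| + |B 1| + |B 2|)) - 1, fun s hs i => ?_⟩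
    have h1 := neg_le_of_abs_le (hB i s hs)
    have := abs_nonneg (B 0)
    have := abs_nonneg (B 1)
    have := abs_nonneg (B 2)
    have : B i ≤ |B 0| + |B 1| + |B 2| := by
      refine (le_abs_self _).trans ?_
      fin_cases i <;> simp <;> linarith
    linarith
  refine ⟨δ * Real.exp (-(L * (t - t₀))), fun p hp => ?_⟩
  have h1 := h.momSq_lt_of_ne_zero hr ht (a := fun s => L * (s - t₀)) (a' := fun _ => L)
    (fun s _ => by simpa using ((hasDerivWithinAt_id s (Icc t₀ t)).sub_const t₀).const_mul L)
    (by simp) hL hδ hinit hp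
  rw [Real.exp_neg, ← div_eq_mul_inv, le_div_iff₀ (Real.exp_pos _)]
  exact h1.le

end Global

/-! ### Monotonicity criteria and the abstract reduced system. -/

theorem antitoneOn_Icc_of_hasDerivWithinAt {φ φ' : ℝ → ℝ} {a b : ℝ}
    (h : ∀ t ∈ Icc a b, HasDerivWithinAt φ (φ' t) (Icc a b) t) (h' : ∀ t ∈ Icc a b, φ' t ≤ 0) :
    AntitoneOn φ (Icc a b) :=
  antitoneOn_of_hasDerivWithinAt_nonpos (convex_Icc a b) (fun t ht => (h t ht).continuousWithinAt)
    (fun t ht => (h t (interior_subset ht)).mono interior_subset)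
    fun t ht => h' t (interior_subset ht)

theorem monotoneOn_Icc_of_hasDerivWithinAt {φ φ' : ℝ → ℝ} {a b : ℝ}
    (h : ∀ t ∈ Icc a b, HasDerivWithinAt φ (φ' t) (Icc a b) t) (h' : ∀ t ∈ Icc a b, 0 ≤ φ' t) :
    MonotoneOn φ (Icc a b) :=
  monotoneOn_of_hasDerivWithinAt_nonneg (convex_Icc a b) (fun t ht => (h t ht).continuousWithinAt)
    (fun t ht => (h t (interior_subset ht)).mono interior_subset)
    fun t ht => h' t (interior_subset ht)

/-- The reduced system for `p = Σ₊`, `m = Σ₋`, `n = N₋` and `M` on `[t₀, t₁]`, where `u = τ - τ₀`,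
`s = S / H²`, and `κ`, `σ` are the contributions of the anisotropic stress; all variables are
assumed to be bounded by `η`, and the initial data by `η⁴`. -/
structure IsSmallOrbit (η t₀ t₁ : ℝ) (u H p m n M s κ σ : ℝ → ℝ) : Prop where
  u_zero : u t₀ = 0
  H_pos : ∀ t ∈ Icc t₀ t₁, 0 < H t
  deriv_u : ∀ t ∈ Icc t₀ t₁, HasDerivWithinAt u (H t) (Icc t₀ t₁) t
  deriv_p : ∀ t ∈ Icc t₀ t₁, HasDerivWithinAt p
    (H t * ((-3 / 2 + (3 / 2 * (p t ^ 2 + m t ^ 2) - n t ^ 2 / 2 + s t / 6)) * p t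
      - 2 * n t ^ 2 + κ t)) (Icc t₀ t₁) t
  deriv_m : ∀ t ∈ Icc t₀ t₁, HasDerivWithinAt m
    (H t * ((-3 / 2 + (3 / 2 * (p t ^ 2 + m t ^ 2) - n t ^ 2 / 2 + s t / 6)) * m t
      - 2 * n t / M t + σ t)) (Icc t₀ t₁) t
  deriv_n : ∀ t ∈ Icc t₀ t₁, HasDerivWithinAt n
    (H t * ((1 / 2 + (3 / 2 * (p t ^ 2 + m t ^ 2) - n t ^ 2 / 2 + s t / 6) + 2 * p t) * n t
      + 2 * m t / M t)) (Icc t₀ t₁) t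
  deriv_M : ∀ t ∈ Icc t₀ t₁, HasDerivWithinAt M
    (-(H t * M t * (1 / 2 + (3 / 2 * (p t ^ 2 + m t ^ 2) - n t ^ 2 / 2 + s t / 6) + 2 * p t
      + 6 * M t * m t * n t))) (Icc t₀ t₁) t
  abs_κ_le : ∀ t ∈ Icc t₀ t₁, |κ t| ≤ s t / 3
  abs_σ_le : ∀ t ∈ Icc t₀ t₁, |σ t| ≤ s t / 3
  s_le : ∀ t ∈ Icc t₀ t₁, s t ≤ 3 * (η ^ 4 * Real.exp ((-2 + 7 * η) * u t))
  abs_p_le : ∀ t ∈ Icc t₀ t₁, |p t| ≤ η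
  amplitude_le : ∀ t ∈ Icc t₀ t₁, m t ^ 2 + n t ^ 2 ≤ η ^ 2
  M_pos : ∀ t ∈ Icc t₀ t₁, 0 < M t
  M_le : ∀ t ∈ Icc t₀ t₁, M t ≤ η
  abs_p_init : |p t₀| ≤ η ^ 4
  amplitude_init : m t₀ ^ 2 + n t₀ ^ 2 ≤ (η ^ 4) ^ 2
  M_init : M t₀ ≤ η ^ 4

/-! ### Algebraic inequalities for small variables. -/

section PointwiseEstimates

variable {η p m n M s A σ : ℝ}

theorem abs_deceleration_sub_half_le (hη : 0 < η) (hη1 : η ≤ 1 / 100) (hp : |p| ≤ η)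
    (hX : m ^ 2 + n ^ 2 ≤ η ^ 2) (hs0 : 0 ≤ s) (hs : s ≤ 3 * η ^ 4) :
    |3 / 2 * (p ^ 2 + m ^ 2) - n ^ 2 / 2 + s / 6| ≤ η := by
  have h1 : p ^ 2 ≤ η ^ 2 := sq_le_sq' (neg_le_of_abs_le hp) (le_of_abs_le hp)
  have h2 : η ^ 2 ≤ η / 100 := by nlinarith
  have h3 : η ^ 4 ≤ η ^ 2 := pow_le_pow_of_le_one hη.le (by linarith) (by norm_num)
  rw [abs_le]
  constructor <;> nlinarith [sq_nonneg p, sq_nonneg m, sq_nonneg n]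

theorem two_mul_abs_mul_le (m n : ℝ) : 2 * |m * n| ≤ m ^ 2 + n ^ 2 := by
  rcases abs_cases (m * n) with h | h <;> nlinarith [sq_nonneg (m - n), sq_nonneg (m + n)]

theorem abs_mul_mul_le (hM : 0 < M) (hMη : M ≤ η) (hX : m ^ 2 + n ^ 2 ≤ η ^ 2) :
    |M * (m * n)| ≤ η ^ 3 / 2 := by
  rw [abs_mul, abs_of_pos hM]
  nlinarith [two_mul_abs_mul_le m n, abs_nonneg (m * n), sq_nonneg η,
    mul_le_mul hMη (le_trans (two_mul_abs_mul_le m n) hX) (by positivity) (hM.le.trans hMη)]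

/-- The corrector `M m n` is at most `η / 2` times `m² + n²`, so the corrected energy is equivalent
to the amplitude. -/
theorem amplitude_le_corrected (hη1 : η ≤ 1 / 100) (hM : 0 < M) (hMη : M ≤ η) :
    m ^ 2 + n ^ 2 ≤ (1 + η) * (m ^ 2 + n ^ 2 + M * (m * n)) := by
  have h1 : |M * (m * n)| ≤ η * ((m ^ 2 + n ^ 2) / 2) := by
    rw [abs_mul, abs_of_pos hM]
    exact mul_le_mul hMη (by linarith [two_mul_abs_mul_le m n]) (abs_nonneg _) (hM.le.trans hMη)
  have h2 := neg_le_of_abs_le h1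
  have hη : 0 < η := hM.trans_le hMη
  nlinarith [mul_nonneg hη.le (add_nonneg (sq_nonneg m) (sq_nonneg n))]

/-- The left side is the `τ`-derivative of `m² + n² + M m n`, in which all factors `1 / M` have
cancelled. Beyond the decay term there are errors of relative size `η` and the matter forcing `σ`.
-/
theorem corrected_amplitude_rate_le {r : ℝ} (hη : 0 < η) (hη1 : η ≤ 1 / 100) (hr : |r| ≤ η)
    (hp : |p| ≤ η) (hM : 0 < M) (hMη : M ≤ η) (hX : m ^ 2 + n ^ 2 ≤ η ^ 2) (hσ : |σ| ≤ A) :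
    -(m ^ 2 + n ^ 2 + M * (m * n)) + 2 * r * (m ^ 2 + n ^ 2) + 4 * p * n ^ 2
        + M * (m * n) * (-1 / 2 + r - 6 * (M * (m * n))) + (2 * m + M * n) * σ
      ≤ -((1 - 16 * η) * (m ^ 2 + n ^ 2 + M * (m * n))) + 5 / (4 * η) * A ^ 2 := by
  set Y := m ^ 2 + n ^ 2 with hY
  have hY0 : 0 ≤ Y := by positivity
  have hE := amplitude_le_corrected (m := m) (n := n) hη1 hM hMη
  set w := M * (m * n) with hw
  have hw1 : |w| ≤ η * (Y / 2) := by
    rw [hw, abs_mul, abs_of_pos hM]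
    exact mul_le_mul hMη (by linarith [two_mul_abs_mul_le m n]) (abs_nonneg _) hη.le
  have hw2 : |w| ≤ η ^ 3 / 2 := abs_mul_mul_le hM hMη hX
  have t1 : 2 * r * Y ≤ 2 * η * Y := by
    have := mul_le_mul_of_nonneg_right (le_of_abs_le hr) hY0
    linarith
  have t2 : 4 * p * n ^ 2 ≤ 4 * η * Y := by
    have h1 := mul_le_mul_of_nonneg_right (le_of_abs_le hp) (sq_nonneg n)
    have h2 := mul_le_mul_of_nonneg_left (show n ^ 2 ≤ Y by rw [hY]; linarith [sq_nonneg m]) hη.le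
    linarith
  have t3 : w * (-1 / 2 + r - 6 * w) ≤ η * (Y / 2) := by
    have h3 : η ^ 3 ≤ η / 100 := by nlinarith [sq_nonneg η, mul_pos hη hη]
    have h1 : |-1 / 2 + r - 6 * w| ≤ 1 := by
      have := abs_le.1 hw2
      have := abs_le.1 hr
      rw [abs_le]
      constructor <;> linarith
    calc w * (-1 / 2 + r - 6 * w) ≤ |w| * |-1 / 2 + r - 6 * w| := by
          rw [← abs_mul]; exact le_abs_self _
      _ ≤ |w| * 1 := mul_le_mul_of_nonneg_left h1 (abs_nonneg _)
      _ ≤ _ := by linarith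
  -- Young's inequality with weight `η / 5`, matched to `(2m + Mn)² ≤ (4 + M²)(m² + n²) ≤ 5 (m² +
  -- n²)`.
  have t4 : (2 * m + M * n) * σ ≤ η * Y + 5 / (4 * η) * A ^ 2 := by
    have hσ2 : σ ^ 2 ≤ A ^ 2 := sq_le_sq' (neg_le_of_abs_le hσ) (le_of_abs_le hσ)
    have h1 : (2 * m + M * n) ^ 2 ≤ 5 * Y := by
      have hM2 : M ^ 2 ≤ 1 := by nlinarith
      nlinarith [sq_nonneg (2 * n - M * m), mul_nonneg hY0 (sub_nonneg.2 hM2)]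
    have h2 : (2 * m + M * n) * σ ≤ η / 5 * (2 * m + M * n) ^ 2 + 5 / (4 * η) * σ ^ 2 := by
      have : η / 5 * (2 * m + M * n) ^ 2 + 5 / (4 * η) * σ ^ 2 - (2 * m + M * n) * σ
          = η / 5 * ((2 * m + M * n) - 5 / (2 * η) * σ) ^ 2 := by
        field_simp
        ring
      have h3 : 0 ≤ η / 5 * ((2 * m + M * n) - 5 / (2 * η) * σ) ^ 2 := by positivity
      linarith
    have h3 : 5 / (4 * η) * σ ^ 2 ≤ 5 / (4 * η) * A ^ 2 := by gcongr
    have h4 := mul_le_mul_of_nonneg_left h1 hη.le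
    linarith
  -- The losses add up to `2 + 4 + 1/2 + 1 = 15/2`; the constant `16` leaves ample room for passing
  -- to the corrected energy.
  have h5 : 15 / 2 * η * Y ≤ 16 * η * (Y + w) := by
    have := mul_le_mul_of_nonneg_left hE hη.le
    have h6 : 0 ≤ Y + w := by
      by_contra! hneg
      nlinarith
    nlinarith [mul_nonneg hη.le h6]
  linarith

end PointwiseEstimates

/-! ### Decay of small orbits. -/

section Decay

variable {η t₀ t₁ : ℝ} {u H p m n M s κ σ : ℝ → ℝ}

namespace IsSmallOrbit

theorem u_nonneg (h : IsSmallOrbit η t₀ t₁ u H p m n M s κ σ) {t : ℝ} (ht : t ∈ Icc t₀ t₁) :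
    0 ≤ u t := by
  rw [← h.u_zero]
  exact monotoneOn_Icc_of_hasDerivWithinAt h.deriv_u (fun t ht => (h.H_pos t ht).le)
    ⟨le_rfl, ht.1.trans ht.2⟩ ht ht.1

theorem s_nonneg (h : IsSmallOrbit η t₀ t₁ u H p m n M s κ σ) {t : ℝ} (ht : t ∈ Icc t₀ t₁) :
    0 ≤ s t := by
  have := (abs_nonneg _).trans (h.abs_κ_le t ht)
  linarith

theorem exp_le_one (h : IsSmallOrbit η t₀ t₁ u H p m n M s κ σ) {c : ℝ} (hc : c ≤ 0) {t : ℝ}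
    (ht : t ∈ Icc t₀ t₁) : Real.exp (c * u t) ≤ 1 :=
  Real.exp_le_one_iff.2 (mul_nonpos_of_nonpos_of_nonneg hc (h.u_nonneg ht))

theorem abs_r_le (h : IsSmallOrbit η t₀ t₁ u H p m n M s κ σ) (hη : 0 < η) (hη1 : η ≤ 1 / 100)
    {t : ℝ} (ht : t ∈ Icc t₀ t₁) :
    |3 / 2 * (p t ^ 2 + m t ^ 2) - n t ^ 2 / 2 + s t / 6| ≤ η := by
  refine abs_deceleration_sub_half_le hη hη1 (h.abs_p_le t ht) (h.amplitude_le t ht)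
    (h.s_nonneg ht) ((h.s_le t ht).trans ?_)
  have h1 := h.exp_le_one (c := -2 + 7 * η) (by linarith) ht
  have h2 : 0 ≤ η ^ 4 := by positivity
  nlinarith

theorem hasDerivWithinAt_exp (h : IsSmallOrbit η t₀ t₁ u H p m n M s κ σ) (c : ℝ) {t : ℝ}
    (ht : t ∈ Icc t₀ t₁) : HasDerivWithinAt (fun t => Real.exp (c * u t))
      (Real.exp (c * u t) * (c * H t)) (Icc t₀ t₁) t :=
  ((h.deriv_u t ht).const_mul c).exp

theorem M_decay (h : IsSmallOrbit η t₀ t₁ u H p m n M s κ σ) (hη : 0 < η) (hη1 : η ≤ 1 / 100)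
    {t : ℝ} (ht : t ∈ Icc t₀ t₁) : M t ≤ η ^ 4 * Real.exp ((-(1 / 2) + 4 * η) * u t) := by
  have hanti := antitoneOn_Icc_of_hasDerivWithinAt (a := t₀) (b := t₁)
    (fun t ht => (h.deriv_M t ht).mul (h.hasDerivWithinAt_exp (1 / 2 - 4 * η) ht)) (by
      intro t ht
      have hM := h.M_pos t ht
      have hH := h.H_pos t ht
      have h1 := abs_le.1 (h.abs_r_le hη hη1 ht)
      have h2 := abs_le.1 (h.abs_p_le t ht)
      have h3 := abs_le.1 (abs_mul_mul_le hM (h.M_le t ht) (h.amplitude_le t ht))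
      have h4 : η ^ 3 ≤ η / 100 := by nlinarith [sq_nonneg η, mul_pos hη hη]
      set r := 3 / 2 * (p t ^ 2 + m t ^ 2) - n t ^ 2 / 2 + s t / 6
      have h5 : 0 ≤ r + 2 * p t + 6 * (M t * (m t * n t)) + 4 * η := by linarith
      have h6 : 0 ≤ H t * M t * Real.exp ((1 / 2 - 4 * η) * u t)
        * (r + 2 * p t + 6 * (M t * (m t * n t)) + 4 * η) := by positivity
      linarith)
  have h1 := hanti ⟨le_rfl, ht.1.trans ht.2⟩ ht ht.1
  -- The loss `4η` in the rate covers `|r| ≤ η`, `2|p| ≤ 2η` and `6 |M m n| ≤ 3 η ^ 3`.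
  simp only [h.u_zero, mul_zero, Real.exp_zero, mul_one, Pi.mul_apply] at h1
  have h2 : (-(1 / 2) + 4 * η) * u t = -((1 / 2 - 4 * η) * u t) := by ring
  rw [h2, Real.exp_neg, ← div_eq_mul_inv, le_div_iff₀ (Real.exp_pos _)]
  exact h1.trans h.M_init

theorem amplitude_decay (h : IsSmallOrbit η t₀ t₁ u H p m n M s κ σ) (hη : 0 < η)
    (hη1 : η ≤ 1 / 100) {t : ℝ} (ht : t ∈ Icc t₀ t₁) :
    m t ^ 2 + n t ^ 2 ≤ η ^ 6 * Real.exp (-((1 - 16 * η) * u t)) := by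
  -- The weighted corrected energy is driven by matter at most like `(5/4) η ^ 7 e^{(-3 - 2η)u}`.
  -- The added term `η ^ 7 e^{-2u}` has derivative `-2 H η ^ 7 e^{-2u}`, which absorbs it.
  have hanti := antitoneOn_Icc_of_hasDerivWithinAt (a := t₀) (b := t₁)
    (fun t ht => (((((h.deriv_m t ht).pow 2).add ((h.deriv_n t ht).pow 2)).add
      ((h.deriv_M t ht).mul ((h.deriv_m t ht).mul (h.deriv_n t ht)))).mul
        (h.hasDerivWithinAt_exp (1 - 16 * η) ht)).add
        ((h.hasDerivWithinAt_exp (-2) ht).const_mul (η ^ 7))) (by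
      intro t ht
      have hM := h.M_pos t ht
      have hH := h.H_pos t ht
      have hσ : |σ t| ≤ η ^ 4 * Real.exp ((-2 + 7 * η) * u t) := by
        have := h.abs_σ_le t ht
        have := h.s_le t ht
        linarith
      have h1 := corrected_amplitude_rate_le hη hη1 (h.abs_r_le hη hη1 ht) (h.abs_p_le t ht) hM
        (h.M_le t ht) (h.amplitude_le t ht) hσ
      set r := 3 / 2 * (p t ^ 2 + m t ^ 2) - n t ^ 2 / 2 + s t / 6
      set e := Real.exp ((1 - 16 * η) * u t) with he
      have he0 : 0 < e := Real.exp_pos _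
      have h2 : 5 / (4 * η) * (η ^ 4 * Real.exp ((-2 + 7 * η) * u t)) ^ 2 * e
          ≤ 2 * η ^ 7 * Real.exp (-2 * u t) := by
        have e1 : 5 / (4 * η) * (η ^ 4 * Real.exp ((-2 + 7 * η) * u t)) ^ 2 * e
            = 5 / 4 * η ^ 7 * Real.exp ((-3 - 2 * η) * u t) := by
          have : Real.exp ((-3 - 2 * η) * u t) = Real.exp ((-2 + 7 * η) * u t) ^ 2 * e := by
            rw [he, sq, ← Real.exp_add, ← Real.exp_add]; ring_nf
          rw [this]
          field_simp
        have e2 : Real.exp ((-3 - 2 * η) * u t) ≤ Real.exp (-2 * u t) := by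
          rw [Real.exp_le_exp]
          nlinarith [h.u_nonneg ht, mul_nonneg hη.le (h.u_nonneg ht)]
        have h7 : 0 < η ^ 7 := by positivity
        have e3 := mul_le_mul_of_nonneg_left e2 h7.le
        have e4 := mul_pos h7 (Real.exp_pos (-2 * u t))
        rw [e1]
        linarith
      have h3 := mul_le_mul_of_nonneg_right h1 he0.le
      have h4 : H t * (((-(m t ^ 2 + n t ^ 2 + M t * (m t * n t)) + 2 * r * (m t ^ 2 + n t ^ 2)
          + 4 * p t * n t ^ 2 + M t * (m t * n t) * (-1 / 2 + r - 6 * (M t * (m t * n t)))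
          + (2 * m t + M t * n t) * σ t)
          + (1 - 16 * η) * (m t ^ 2 + n t ^ 2 + M t * (m t * n t))) * e
          - 2 * η ^ 7 * Real.exp (-2 * u t)) ≤ 0 :=
        mul_nonpos_of_nonneg_of_nonpos hH.le (by linarith)
      refine le_of_eq_of_le ?_ h4
      simp only [Pi.pow_apply, Pi.mul_apply, Pi.add_apply, Nat.cast_ofNat]
      field_simp
      ring)
  have h1 := hanti ⟨le_rfl, ht.1.trans ht.2⟩ ht ht.1
  simp only [h.u_zero, mul_zero, Real.exp_zero, mul_one, Pi.mul_apply, Pi.add_apply,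
    Pi.pow_apply] at h1
  have hM0 := h.M_pos t₀ ⟨le_rfl, ht.1.trans ht.2⟩
  have h2 := amplitude_le_corrected (m := m t) (n := n t) hη1 (h.M_pos t ht) (h.M_le t ht)
  have h3 := h.amplitude_init
  have h4 := abs_mul_mul_le hM0 (h.M_le t₀ ⟨le_rfl, ht.1.trans ht.2⟩)
    (h.amplitude_le t₀ ⟨le_rfl, ht.1.trans ht.2⟩)
  have h5 : M t₀ * (m t₀ * n t₀) ≤ (m t₀ ^ 2 + n t₀ ^ 2) := by
    have e1 := two_mul_abs_mul_le (m t₀) (n t₀)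
    have e2 := le_abs_self (m t₀ * n t₀)
    have e3 := h.M_le t₀ ⟨le_rfl, ht.1.trans ht.2⟩
    have e4 := abs_nonneg (m t₀ * n t₀)
    nlinarith [mul_le_mul_of_nonneg_left e2 hM0.le, mul_le_mul_of_nonneg_right e3 e4]
  set E := m t ^ 2 + n t ^ 2 + M t * (m t * n t)
  have h6 : E * Real.exp ((1 - 16 * η) * u t) ≤ 2 * (η ^ 4) ^ 2 + η ^ 7 := by
    have : 0 < η ^ 7 * Real.exp (-2 * u t) := by positivity
    linarith
  rw [Real.exp_neg, ← div_eq_mul_inv, le_div_iff₀ (Real.exp_pos _)]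
  have h7 : (m t ^ 2 + n t ^ 2) * Real.exp ((1 - 16 * η) * u t)
      ≤ (1 + η) * (2 * (η ^ 4) ^ 2 + η ^ 7) := by
    have := mul_le_mul_of_nonneg_right h2 (Real.exp_pos ((1 - 16 * η) * u t)).le
    have := mul_le_mul_of_nonneg_left h6 (show 0 ≤ 1 + η by linarith)
    linarith
  refine h7.trans ?_
  have h8 : (1 + η) * (2 * (η ^ 4) ^ 2 + η ^ 7) = ((1 + η) * (2 * η ^ 2 + η)) * η ^ 6 := by ring
  rw [h8]
  have h9 : (1 + η) * (2 * η ^ 2 + η) ≤ 1 := by nlinarith [mul_pos hη hη]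
  have h10 : 0 ≤ η ^ 6 := by positivity
  nlinarith

theorem p_decay (h : IsSmallOrbit η t₀ t₁ u H p m n M s κ σ) (hη : 0 < η)
    (hη1 : η ≤ 1 / 100) {t : ℝ} (ht : t ∈ Icc t₀ t₁) :
    |p t| ≤ 4 * η ^ 4 * Real.exp (-((1 - 16 * η) * u t)) := by
  -- Put `y = p e^{(1 - 16η)u}`. In `τ`-time `y' = (-1/2 - 16η + r) y + b` with `|b| ≤ 2 η ^ 4`, so
  -- `|y|` is trapped at the level `2 · 2 η ^ 4`. In squared form, `(y² - 16 η ^ 8) e^{u/2}` is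
  -- nonincreasing and starts negative.
  have hanti := antitoneOn_Icc_of_hasDerivWithinAt (a := t₀) (b := t₁)
    (fun t ht => ((((h.deriv_p t ht).mul (h.hasDerivWithinAt_exp (1 - 16 * η) ht)).pow 2).sub_const
        (16 * η ^ 8)).mul (h.hasDerivWithinAt_exp (1 / 2) ht)) (by
      intro t ht
      have hH := h.H_pos t ht
      have hX := h.amplitude_decay hη hη1 ht
      have hκ : |κ t| ≤ η ^ 4 * Real.exp ((-2 + 7 * η) * u t) := by
        have := h.abs_κ_le t ht
        have := h.s_le t ht
        linarith
      have hr := abs_le.1 (h.abs_r_le hη hη1 ht)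
      set r := 3 / 2 * (p t ^ 2 + m t ^ 2) - n t ^ 2 / 2 + s t / 6
      set e := Real.exp ((1 - 16 * η) * u t) with he
      have he0 : 0 < e := Real.exp_pos _
      have hX' : (m t ^ 2 + n t ^ 2) * e ≤ η ^ 6 := by
        rw [Real.exp_neg, ← div_eq_mul_inv, le_div_iff₀ he0] at hX
        exact hX
      have hκ' : |κ t| * e ≤ η ^ 4 := by
        have e1 := mul_le_mul_of_nonneg_right hκ he0.le
        have e2 : Real.exp ((-2 + 7 * η) * u t) * e = Real.exp ((-1 - 9 * η) * u t) := by
          rw [he, ← Real.exp_add]; ring_nf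
        have e3 := h.exp_le_one (c := -1 - 9 * η) (by linarith) ht
        have e4 : 0 ≤ η ^ 4 := by positivity
        rw [mul_assoc, e2] at e1
        nlinarith
      set b := (-2 * n t ^ 2 + κ t) * e with hb
      have hb1 : |b| ≤ 2 * η ^ 4 := by
        have e1 : η ^ 6 ≤ η ^ 4 / 100 := by
          have : 0 < η ^ 4 := by positivity
          have e2 : η ^ 6 = η ^ 4 * η ^ 2 := by ring
          have e3 : η ^ 2 ≤ 1 / 100 := by nlinarith
          nlinarith [mul_le_mul_of_nonneg_left e3 this.le]
        have e2 := mul_nonneg (sq_nonneg (m t)) he0.le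
        have e3 := mul_nonneg (sq_nonneg (n t)) he0.le
        have e4 := mul_le_mul_of_nonneg_right (le_abs_self (κ t)) he0.le
        have e5 := mul_le_mul_of_nonneg_right (neg_abs_le (κ t)) he0.le
        rw [hb, abs_le]
        constructor <;> linarith
      have hb2 : b ^ 2 ≤ 4 * η ^ 8 := by
        have := sq_le_sq' (neg_le_of_abs_le hb1) (le_of_abs_le hb1)
        nlinarith
      have h2 : 2 * (p t * e) * ((-1 / 2 - 16 * η + r) * (p t * e) + b)
          + 1 / 2 * ((p t * e) ^ 2 - 16 * η ^ 8) ≤ 0 := by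
        have e1 : (r - 16 * η) * (p t * e) ^ 2 ≤ 0 :=
          mul_nonpos_of_nonpos_of_nonneg (by linarith) (sq_nonneg _)
        -- Completing the square: `-y²/2 + 2 y b - 8 η ^ 8 ≤ -(y - 2b)²/2`, because `b² ≤ 4 η ^ 8`.
        nlinarith [sq_nonneg (p t * e - 2 * b)]
      have h3 : H t * (2 * (p t * e) * ((-1 / 2 - 16 * η + r) * (p t * e) + b)
          + 1 / 2 * ((p t * e) ^ 2 - 16 * η ^ 8)) * Real.exp (1 / 2 * u t) ≤ 0 :=
        mul_nonpos_of_nonpos_of_nonneg (mul_nonpos_of_nonneg_of_nonpos hH.le h2)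
          (Real.exp_pos _).le
      refine le_of_eq_of_le ?_ h3
      simp only [Pi.pow_apply, Pi.mul_apply, Nat.cast_ofNat]
      rw [hb]
      ring)
  have h1 := hanti ⟨le_rfl, ht.1.trans ht.2⟩ ht ht.1
  simp only [h.u_zero, mul_zero, Real.exp_zero, mul_one, Pi.mul_apply, Pi.pow_apply] at h1
  have h2 : p t₀ ^ 2 ≤ (η ^ 4) ^ 2 :=
    sq_le_sq' (neg_le_of_abs_le h.abs_p_init) (le_of_abs_le h.abs_p_init)
  have h3 : (p t * Real.exp ((1 - 16 * η) * u t)) ^ 2 ≤ (4 * η ^ 4) ^ 2 := by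
    by_contra! hcon
    have := mul_pos (sub_pos.2 hcon) (Real.exp_pos (1 / 2 * u t))
    have : 0 < η ^ 8 := by positivity
    nlinarith
  have h4 := abs_le_of_sq_le_sq h3 (by positivity)
  rw [Real.exp_neg, ← div_eq_mul_inv, le_div_iff₀ (Real.exp_pos _)]
  rwa [abs_mul, abs_of_pos (Real.exp_pos _)] at h4

end IsSmallOrbit

end Decay

/-! ### Derivation of the expansion-normalised equations. -/

section ReducedSystem

theorem hasDerivWithinAt_sqrt_of_logDeriv {φ : ℝ → ℝ} {c t : ℝ} {I : Set ℝ}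
    (h : HasDerivWithinAt φ (2 * φ t * c) I t) (h0 : 0 < φ t) :
    HasDerivWithinAt (fun s => √(φ s)) (√(φ t) * c) I t := by
  refine (h.sqrt h0.ne').congr_deriv ?_
  have h1 : √(φ t) ≠ 0 := (Real.sqrt_pos.2 h0).ne'
  have h2 := Real.sq_sqrt h0.le
  rw [div_eq_iff (by positivity)]
  linear_combination (-2 * c) * h2

theorem hasDerivWithinAt_div_hubble {y H : ℝ → ℝ} {y' H' t : ℝ} {I : Set ℝ}
    (hy : HasDerivWithinAt y y' I t) (hH : HasDerivWithinAt H H' I t) (h0 : H t ≠ 0) :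
    HasDerivWithinAt (fun s => y s / H s) ((y' - y t / H t * H') / H t) I t := by
  refine (hy.div hH h0).congr_deriv ?_
  field_simp

variable {t₀ : ℝ} {T : EReal} {g k : ℝ → Mat3} {f : ℝ → (Fin 3 → ℝ) → ℝ}

theorem IsSolution.hasDerivWithinAt_metric {C : Fin 3 → Fin 3 → Fin 3 → ℝ}
    (h : IsSolution C t₀ T g k f) {t : ℝ} (ht : t ∈ timeInterval t₀ T) (i : Fin 3) :
    HasDerivWithinAt (fun s => g s i i) (2 * g t i i * expRate (g t) (k t) i)
      (timeInterval t₀ T) t := by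
  refine (h.evol_g t ht i i).congr_deriv ?_
  have := (h.metric_pos ht i).ne'
  rw [expRate]
  field_simp

theorem IsSolution.hasDerivWithinAt_sqrt_ratio {C : Fin 3 → Fin 3 → Fin 3 → ℝ}
    (h : IsSolution C t₀ T g k f) {t : ℝ} (ht : t ∈ timeInterval t₀ T) (i j l : Fin 3) :
    HasDerivWithinAt (fun s => √(g s i i / (g s j j * g s l l)))
      (√(g t i i / (g t j j * g t l l)) * (expRate (g t) (k t) i - expRate (g t) (k t) j
        - expRate (g t) (k t) l)) (timeInterval t₀ T) t := by
  have hi := h.metric_pos ht i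
  have hj := h.metric_pos ht j
  have hl := h.metric_pos ht l
  refine hasDerivWithinAt_sqrt_of_logDeriv (φ := fun s => g s i i / (g s j j * g s l l)) ?_
    (by positivity)
  refine ((h.hasDerivWithinAt_metric ht i).div ((h.hasDerivWithinAt_metric ht j).mul
    (h.hasDerivWithinAt_metric ht l)) (by simp [hj.ne', hl.ne'])).congr_deriv ?_
  simp only [Pi.mul_apply]
  field_simp
  ring

section Variables

variable {g k : Mat3}

theorem Nplus_pos (hpos : ∀ i, 0 < g i i) (hH : 0 < hubble g k) : 0 < Nplus g k := by
  have := hpos 0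
  have := hpos 1
  have := hpos 2
  rw [Nplus, N22, N33]
  positivity

theorem varM_pos (hpos : ∀ i, 0 < g i i) (hH : 0 < hubble g k) : 0 < varM g k :=
  one_div_pos.2 (Nplus_pos hpos hH)

theorem expRate_one_eq (hg : g.IsDiag) (hpos : ∀ i, 0 < g i i) (hH : hubble g k ≠ 0) :
    expRate g k 1 = hubble g k * (1 + sigmaPlus g k + √3 * sigmaMinus g k) := by
  have h3 : √3 ≠ 0 := by simp
  rw [sigmaPlus_eq hg hpos, sigmaMinus_eq hg hpos]
  field_simp
  ring

theorem expRate_two_eq (hg : g.IsDiag) (hpos : ∀ i, 0 < g i i) (hH : hubble g k ≠ 0) :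
    expRate g k 2 = hubble g k * (1 + sigmaPlus g k - √3 * sigmaMinus g k) := by
  have h3 : √3 ≠ 0 := by simp
  rw [sigmaPlus_eq hg hpos, sigmaMinus_eq hg hpos]
  field_simp
  ring

theorem expRate_zero_eq (hg : g.IsDiag) (hpos : ∀ i, 0 < g i i) (hH : hubble g k ≠ 0) :
    expRate g k 0 = hubble g k * (1 - 2 * sigmaPlus g k) := by
  linear_combination -expRate_one_eq hg hpos hH - expRate_two_eq hg hpos hH
    - 3 * hubble_eq hg hpos k

theorem sqrt_ratio_one_eq (hH : hubble g k ≠ 0) : √(g 1 1 / (g 2 2 * g 0 0))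
    = hubble g k * (Nplus g k + √3 * Nminus g k) := by
  have h3 : √3 ≠ 0 := by simp
  rw [Nplus, Nminus, N22, N33]
  field_simp
  ring

theorem sqrt_ratio_two_eq (hH : hubble g k ≠ 0) : √(g 2 2 / (g 0 0 * g 1 1))
    = hubble g k * (Nplus g k - √3 * Nminus g k) := by
  have h3 : √3 ≠ 0 := by simp
  rw [Nplus, Nminus, N22, N33]
  field_simp
  ring

/-- With `n_2`, `n_3` the unnormalised square roots, `n_2 n_3 = 1 / g_{11}`, so the left side is
`(n_2 - n_3)²`. -/
theorem curvature_eq (hpos : ∀ i, 0 < g i i) (hH : hubble g k ≠ 0) :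
    (g 1 1 - g 2 2) ^ 2 / (g 0 0 * g 1 1 * g 2 2) = 12 * hubble g k ^ 2 * Nminus g k ^ 2 := by
  have h0 := hpos 0
  have h1 := hpos 1
  have h2 := hpos 2
  have e1 := Real.sq_sqrt (show 0 ≤ g 1 1 / (g 2 2 * g 0 0) by positivity)
  have e2 := Real.sq_sqrt (show 0 ≤ g 2 2 / (g 0 0 * g 1 1) by positivity)
  have e3 : √(g 1 1 / (g 2 2 * g 0 0)) * √(g 2 2 / (g 0 0 * g 1 1)) = 1 / g 0 0 := by
    rw [← Real.sqrt_mul (by positivity), Real.sqrt_eq_iff_mul_self_eq_of_pos (by positivity)]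
    field_simp
  have e4 : (g 1 1 - g 2 2) ^ 2 / (g 0 0 * g 1 1 * g 2 2)
      = g 1 1 / (g 2 2 * g 0 0) + g 2 2 / (g 0 0 * g 1 1) - 2 * (1 / g 0 0) := by
    field_simp
    ring
  rw [e4, ← e1, ← e2, ← e3, sqrt_ratio_one_eq hH, sqrt_ratio_two_eq hH]
  linear_combination 4 * hubble g k ^ 2 * Nminus g k ^ 2 * Real.sq_sqrt (show (0 : ℝ) ≤ 3 by simp)

theorem curvature_diff_eq (hpos : ∀ i, 0 < g i i) (hH : hubble g k ≠ 0) :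
    (g 1 1 ^ 2 - g 2 2 ^ 2) / (g 0 0 * g 1 1 * g 2 2)
      = 4 * √3 * hubble g k ^ 2 * Nplus g k * Nminus g k := by
  have h0 := hpos 0
  have h1 := hpos 1
  have h2 := hpos 2
  have e1 := Real.sq_sqrt (show 0 ≤ g 1 1 / (g 2 2 * g 0 0) by positivity)
  have e2 := Real.sq_sqrt (show 0 ≤ g 2 2 / (g 0 0 * g 1 1) by positivity)
  have e4 : (g 1 1 ^ 2 - g 2 2 ^ 2) / (g 0 0 * g 1 1 * g 2 2)
      = g 1 1 / (g 2 2 * g 0 0) - g 2 2 / (g 0 0 * g 1 1) := by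
    field_simp
  rw [e4, ← e1, ← e2, sqrt_ratio_one_eq hH, sqrt_ratio_two_eq hH]
  ring

end Variables

/-- The Hamiltonian constraint in expansion-normalised variables. -/
theorem IsSolution.rho_eq (h : IsSolution structVII0 t₀ T g k f)
    (hr : IsReflectionSymmetric t₀ T g k f) {t : ℝ} (ht : t ∈ timeInterval t₀ T)
    (hH : hubble (g t) (k t) ≠ 0) :
    rho (g t) (f t) = 3 * hubble (g t) (k t) ^ 2 * (1 - sigmaPlus (g t) (k t) ^ 2
      - sigmaMinus (g t) (k t) ^ 2 - Nminus (g t) (k t) ^ 2) := by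
  have hp := h.metric_pos ht
  have hg := hr.diag_g t ht
  have h1 := h.hamiltonian_eq hr ht
  have h2 : (g t 1 1 - g t 2 2) ^ 2 / (2 * g t 0 0 * g t 1 1 * g t 2 2)
      = 6 * hubble (g t) (k t) ^ 2 * Nminus (g t) (k t) ^ 2 := by
    have : (g t 1 1 - g t 2 2) ^ 2 / (2 * g t 0 0 * g t 1 1 * g t 2 2)
        = (g t 1 1 - g t 2 2) ^ 2 / (g t 0 0 * g t 1 1 * g t 2 2) / 2 := by
      rw [div_div]; ring_nf
    rw [this, curvature_eq hp hH]
    ring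
  rw [h2, expRate_zero_eq hg hp hH, expRate_one_eq hg hp hH, expRate_two_eq hg hp hH] at h1
  linear_combination h1 / 2 - hubble (g t) (k t) ^ 2 * sigmaMinus (g t) (k t) ^ 2
    * Real.sq_sqrt (show (0 : ℝ) ≤ 3 by simp)

/-- `q - 1/2`, where `q` is the deceleration parameter. -/
noncomputable def decelDev (g k : Mat3) (F : (Fin 3 → ℝ) → ℝ) : ℝ :=
  3 / 2 * (sigmaPlus g k ^ 2 + sigmaMinus g k ^ 2) - Nminus g k ^ 2 / 2
    + tr g (stress g F) / hubble g k ^ 2 / 6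

/-- Eliminating `ρ` and the curvature by the Hamiltonian constraint turns the equation for `H` into
`-(1 + q) H²`. -/
theorem IsSolution.hasDerivWithinAt_hubble' (h : IsSolution structVII0 t₀ T g k f)
    (hr : IsReflectionSymmetric t₀ T g k f) {t : ℝ} (ht : t ∈ timeInterval t₀ T)
    (hH : hubble (g t) (k t) ≠ 0) :
    HasDerivWithinAt (fun s => hubble (g s) (k s))
      (-(hubble (g t) (k t) ^ 2 * (3 / 2 + decelDev (g t) (k t) (f t)))) (timeInterval t₀ T) t := by
  refine (h.hasDerivWithinAt_hubble hr ht).congr_deriv ?_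
  have h2 : (g t 1 1 - g t 2 2) ^ 2 / (6 * g t 0 0 * g t 1 1 * g t 2 2)
      = 2 * hubble (g t) (k t) ^ 2 * Nminus (g t) (k t) ^ 2 := by
    have : (g t 1 1 - g t 2 2) ^ 2 / (6 * g t 0 0 * g t 1 1 * g t 2 2)
        = (g t 1 1 - g t 2 2) ^ 2 / (g t 0 0 * g t 1 1 * g t 2 2) / 6 := by
      rw [div_div]; ring_nf
    rw [this, curvature_eq (h.metric_pos ht) hH]
    ring
  rw [h2, h.rho_eq hr ht hH, decelDev]
  field_simp
  ring

theorem IsSolution.hasDerivWithinAt_sigmaPlus (h : IsSolution structVII0 t₀ T g k f)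
    (hr : IsReflectionSymmetric t₀ T g k f) {t : ℝ} (ht : t ∈ timeInterval t₀ T)
    (hH : hubble (g t) (k t) ≠ 0) :
    HasDerivWithinAt (fun s => sigmaPlus (g s) (k s))
      (hubble (g t) (k t) * ((-3 / 2 + decelDev (g t) (k t) (f t)) * sigmaPlus (g t) (k t)
        - 2 * Nminus (g t) (k t) ^ 2
        + (tr (g t) (stress (g t) (f t)) / 3 - stress (g t) (f t) 0 0 / g t 0 0)
          / 2 / hubble (g t) (k t) ^ 2)) (timeInterval t₀ T) t := by
  have hp := h.metric_pos ht
  have hg := hr.diag_g t ht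
  have hd := hasDerivWithinAt_div_hubble ((((h.hasDerivWithinAt_expRate hr ht 1).add
    (h.hasDerivWithinAt_expRate hr ht 2)).sub ((h.hasDerivWithinAt_hubble' hr ht hH).const_mul
      2)).div_const 2) (h.hasDerivWithinAt_hubble' hr ht hH) hH
  refine (hd.congr_deriv ?_).congr
    (fun s hs => sigmaPlus_eq (hr.diag_g s hs) (h.metric_pos hs) (k s)) (sigmaPlus_eq hg hp _)
  -- The Ricci terms cancel in the sum. The forcing `-2 N₋²` comes instead from `ρ`, through the
  -- constraint, and from the derivative of `H`.
  have e1 : ricci structVII0 (g t) 1 1 / g t 1 1 + ricci structVII0 (g t) 2 2 / g t 2 2 = 0 := by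
    have := (hp 0).ne'
    have := (hp 1).ne'
    have := (hp 2).ne'
    rw [ricci_one_of_diag hg hp, ricci_two_of_diag hg hp]
    field_simp
    ring
  have e2 := sigmaPlus_eq hg hp (k t)
  have e3 := tr_eq_of_diag hg hp (stress (g t) (f t))
  have e4 := h.rho_eq hr ht hH
  have e5 := expRate_one_eq hg hp hH
  have e6 := expRate_two_eq hg hp hH
  simp only [Pi.add_apply, Pi.sub_apply]
  rw [← e2, div_eq_iff hH, decelDev]
  set S := tr (g t) (stress (g t) (f t))
  set H := hubble (g t) (k t)
  field_simp
  rw [e5, e6, e4, show stress (g t) (f t) 1 1 / g t 1 1 = S - stress (g t) (f t) 0 0 / g t 0 0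
    - stress (g t) (f t) 2 2 / g t 2 2 by linarith]
  linear_combination -36 * e1

/-- The Ricci difference is proportional to `N₊ N₋`, and `N₊ = 1 / M`. Together with the
opposite-sign term in the equation for `N₋` it produces the fast rotation of `(Σ₋, N₋)`. -/
theorem IsSolution.hasDerivWithinAt_sigmaMinus (h : IsSolution structVII0 t₀ T g k f)
    (hr : IsReflectionSymmetric t₀ T g k f) {t : ℝ} (ht : t ∈ timeInterval t₀ T)
    (hH : hubble (g t) (k t) ≠ 0) :
    HasDerivWithinAt (fun s => sigmaMinus (g s) (k s))
      (hubble (g t) (k t) * ((-3 / 2 + decelDev (g t) (k t) (f t)) * sigmaMinus (g t) (k t)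
        - 2 * Nminus (g t) (k t) / varM (g t) (k t)
        + (stress (g t) (f t) 1 1 / g t 1 1 - stress (g t) (f t) 2 2 / g t 2 2)
          / (2 * √3) / hubble (g t) (k t) ^ 2)) (timeInterval t₀ T) t := by
  have hp := h.metric_pos ht
  have hg := hr.diag_g t ht
  have h3 : √3 ≠ 0 := by simp
  have hd := hasDerivWithinAt_div_hubble (((h.hasDerivWithinAt_expRate hr ht 1).sub
    (h.hasDerivWithinAt_expRate hr ht 2)).div_const (2 * √3))
    (h.hasDerivWithinAt_hubble' hr ht hH) hH
  refine (hd.congr_deriv ?_).congr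
    (fun s hs => sigmaMinus_eq (hr.diag_g s hs) (h.metric_pos hs) (k s)) (sigmaMinus_eq hg hp _)
  have e1 : ricci structVII0 (g t) 1 1 / g t 1 1 - ricci structVII0 (g t) 2 2 / g t 2 2
      = 4 * √3 * hubble (g t) (k t) ^ 2 * Nplus (g t) (k t) * Nminus (g t) (k t) := by
    rw [← curvature_diff_eq hp hH]
    have := (hp 0).ne'
    have := (hp 1).ne'
    have := (hp 2).ne'
    rw [ricci_one_of_diag hg hp, ricci_two_of_diag hg hp]
    field_simp
    ring
  have e2 := sigmaMinus_eq hg hp (k t)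
  have e5 := expRate_one_eq hg hp hH
  have e6 := expRate_two_eq hg hp hH
  simp only [Pi.sub_apply]
  rw [← e2, div_eq_iff hH, varM]
  set H := hubble (g t) (k t)
  set r := decelDev (g t) (k t) (f t)
  set s1 := stress (g t) (f t) 1 1 / g t 1 1
  set s2 := stress (g t) (f t) 2 2 / g t 2 2
  field_simp
  rw [e5, e6]
  linear_combination -2 * e1

theorem IsSolution.hasDerivWithinAt_Nminus (h : IsSolution structVII0 t₀ T g k f)
    (hr : IsReflectionSymmetric t₀ T g k f) {t : ℝ} (ht : t ∈ timeInterval t₀ T)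
    (hH : hubble (g t) (k t) ≠ 0) :
    HasDerivWithinAt (fun s => Nminus (g s) (k s))
      (hubble (g t) (k t) * ((1 / 2 + decelDev (g t) (k t) (f t) + 2 * sigmaPlus (g t) (k t))
        * Nminus (g t) (k t) + 2 * sigmaMinus (g t) (k t) / varM (g t) (k t)))
      (timeInterval t₀ T) t := by
  have hp := h.metric_pos ht
  have hg := hr.diag_g t ht
  have h3 : √3 ≠ 0 := by simp
  have hd := hasDerivWithinAt_div_hubble (((h.hasDerivWithinAt_sqrt_ratio ht 1 2 0).sub
    (h.hasDerivWithinAt_sqrt_ratio ht 2 0 1)).div_const (2 * √3))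
    (h.hasDerivWithinAt_hubble' hr ht hH) hH
  have e2 : ∀ s, Nminus (g s) (k s) = (√(g s 1 1 / (g s 2 2 * g s 0 0))
      - √(g s 2 2 / (g s 0 0 * g s 1 1))) / (2 * √3) / hubble (g s) (k s) := fun s => by
    rw [Nminus, N22, N33]; ring
  refine (hd.congr_deriv ?_).congr (fun s _ => e2 s) (e2 t)
  simp only [Pi.sub_apply]
  rw [← e2, div_eq_iff hH, varM, expRate_zero_eq hg hp hH, expRate_one_eq hg hp hH,
    expRate_two_eq hg hp hH, sqrt_ratio_one_eq hH, sqrt_ratio_two_eq hH]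
  field_simp
  ring

theorem IsSolution.hasDerivWithinAt_varM (h : IsSolution structVII0 t₀ T g k f)
    (hr : IsReflectionSymmetric t₀ T g k f) {t : ℝ} (ht : t ∈ timeInterval t₀ T)
    (hH : 0 < hubble (g t) (k t)) :
    HasDerivWithinAt (fun s => varM (g s) (k s))
      (-(hubble (g t) (k t) * varM (g t) (k t) * (1 / 2 + decelDev (g t) (k t) (f t)
        + 2 * sigmaPlus (g t) (k t) + 6 * varM (g t) (k t) * sigmaMinus (g t) (k t)
          * Nminus (g t) (k t)))) (timeInterval t₀ T) t := by
  have hp := h.metric_pos ht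
  have hg := hr.diag_g t ht
  have hN := (Nplus_pos hp hH).ne'
  have hd := hasDerivWithinAt_div_hubble (((h.hasDerivWithinAt_sqrt_ratio ht 1 2 0).add
    (h.hasDerivWithinAt_sqrt_ratio ht 2 0 1)).div_const 2)
    (h.hasDerivWithinAt_hubble' hr ht hH.ne') hH.ne'
  have e2 : ∀ s, Nplus (g s) (k s) = (√(g s 1 1 / (g s 2 2 * g s 0 0))
      + √(g s 2 2 / (g s 0 0 * g s 1 1))) / 2 / hubble (g s) (k s) := fun s => by
    rw [Nplus, N22, N33]; ring
  have hd2 := hd.congr (fun s _ => e2 s) (e2 t)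
  have hd3 := (hasDerivWithinAt_const t (timeInterval t₀ T) (1 : ℝ)).div hd2 hN
  refine hd3.congr_deriv ?_
  simp only [Pi.add_apply]
  rw [← e2, varM, expRate_zero_eq hg hp hH.ne', expRate_one_eq hg hp hH.ne',
    expRate_two_eq hg hp hH.ne', sqrt_ratio_one_eq hH.ne', sqrt_ratio_two_eq hH.ne']
  have := hH.ne'
  field_simp
  linear_combination (-4 * hubble (g t) (k t) * sigmaMinus (g t) (k t) * Nminus (g t) (k t)) *
    Real.sq_sqrt (show (0 : ℝ) ≤ 3 by simp)

end ReducedSystem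

/-! ### The bootstrap and its global consequences. -/

/-- At the first time where `φ = η`, the bound `φ ≤ η` has held throughout, so the improvement
contradicts equality. -/
theorem forall_lt_of_continuousOn_of_improvement {φ : ℝ → ℝ} {a b η : ℝ}
    (hc : ContinuousOn φ (Icc a b)) (ha : φ a < η)
    (himp : ∀ s ∈ Icc a b, (∀ r ∈ Icc a s, φ r ≤ η) → φ s < η) : ∀ s ∈ Icc a b, φ s < η := by
  by_contra! hcon
  obtain ⟨s, hs, hηs⟩ := hcon
  have hivt : ∀ r ∈ Icc a b, η ≤ φ r → ∃ x ∈ Icc a r, φ x = η := fun r hr hηr => by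
    obtain ⟨x, hx, hxη⟩ := intermediate_value_Icc hr.1 (hc.mono (Icc_subset_Icc_right hr.2))
      ⟨ha.le, hηr⟩
    exact ⟨x, hx, hxη⟩
  have hK : IsCompact (Icc a b ∩ φ ⁻¹' {η}) := isCompact_Icc.of_isClosed_subset
    (hc.preimage_isClosed_of_isClosed isClosed_Icc isClosed_singleton) inter_subset_left
  obtain ⟨x, hx, hxη⟩ := hivt s hs hηs
  obtain ⟨y, hy, hmin⟩ := hK.exists_isLeast ⟨x, ⟨hx.1, hx.2.trans hs.2⟩, hxη⟩
  refine absurd (himp y hy.1 fun r hr => ?_) (not_lt.2 (le_of_eq hy.2.symm))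
  by_contra! hgt
  have hr' : r ∈ Icc a b := ⟨hr.1, hr.2.trans hy.1.2⟩
  obtain ⟨z, hz, hzη⟩ := hivt r hr' hgt.le
  have h1 : y ≤ z := hmin ⟨⟨hz.1, hz.2.trans hr'.2⟩, hzη⟩
  have h2 : r = y := le_antisymm hr.2 (h1.trans hz.2)
  rw [h2] at hgt
  exact absurd hy.2 hgt.ne'

section Global

variable {t₀ : ℝ} {T : EReal} {g k : ℝ → Mat3} {f : ℝ → (Fin 3 → ℝ) → ℝ}

theorem IsSolution.continuousOn_hubble (h : IsSolution structVII0 t₀ T g k f)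
    (hr : IsReflectionSymmetric t₀ T g k f) :
    ContinuousOn (fun t => hubble (g t) (k t)) (timeInterval t₀ T) :=
  fun _ ht => (h.hasDerivWithinAt_hubble hr ht).continuousWithinAt

theorem IsSolution.hasDerivWithinAt_tau (h : IsSolution structVII0 t₀ T g k f)
    (hr : IsReflectionSymmetric t₀ T g k f) (τ₀ : ℝ) {t₁ : ℝ} (ht₁ : t₁ ∈ timeInterval t₀ T)
    {t : ℝ} (ht : t ∈ Icc t₀ t₁) :
    HasDerivWithinAt (fun s => tau τ₀ t₀ g k s - τ₀) (hubble (g t) (k t)) (Icc t₀ t₁) t := by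
  have hc := (h.continuousOn_hubble hr).mono (Icc_subset_timeInterval ht₁)
  have : Fact (t ∈ Icc t₀ t₁) := ⟨ht⟩
  have hint : IntervalIntegrable (fun s => hubble (g s) (k s)) volume t₀ t :=
    (hc.mono (by rw [uIcc_of_le ht.1]; exact Icc_subset_Icc_right ht.2)).intervalIntegrable
  have hd := intervalIntegral.integral_hasDerivWithinAt_right hint (s := Icc t₀ t₁)
    (t := Icc t₀ t₁) (hc.stronglyMeasurableAtFilter_nhdsWithin measurableSet_Icc t) (hc t ht)
  simpa [tau] using hd

/-- `H e^{3(τ - τ₀)}` does not fall below its initial value. -/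
theorem IsSolution.hubble_mul_exp_ge (h : IsSolution structVII0 t₀ T g k f)
    (hr : IsReflectionSymmetric t₀ T g k f) {δ : ℝ} (hδ : 0 < δ)
    (hinit : ∀ p, δ ≤ momSq (g t₀) p → f t₀ p = 0) (τ₀ : ℝ) {t : ℝ} (ht : t ∈ timeInterval t₀ T) :
    hubble (g t₀) (k t₀)
      ≤ hubble (g t) (k t) * Real.exp (3 * (tau τ₀ t₀ g k t - τ₀)) := by
  have hJ := Icc_subset_timeInterval ht
  have hmono := monotoneOn_Icc_of_hasDerivWithinAt (a := t₀) (b := t) (fun s hs =>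
    ((h.hasDerivWithinAt_hubble hr (hJ hs)).mono hJ).mul
      (((h.hasDerivWithinAt_tau hr τ₀ ht hs).const_mul 3).exp)) (by
    intro s hs
    have hp := h.metric_pos (hJ hs)
    have hg := hr.diag_g s (hJ hs)
    have h0 := hp 0
    have h1 := hp 1
    have h2 := hp 2
    obtain ⟨A, hA⟩ := h.exists_momSq_le hr hδ hinit (hJ hs)
    have hS := tr_stress_le_self_rho hg hp (h.continuous_distribution (hJ hs))
      (h.nonneg_f s (hJ hs)) hA
    have hρ : 0 ≤ rho (g s) (f s) := rho_nonneg (h.nonneg_f s (hJ hs))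
    have hR : 0 ≤ (g s 1 1 - g s 2 2) ^ 2 / (6 * g s 0 0 * g s 1 1 * g s 2 2) := by positivity
    -- The weight cancels `-3 H²`, and what is left is nonnegative since `S ≤ ρ`.
    have e : 0 ≤ ((g s 1 1 - g s 2 2) ^ 2 / (6 * g s 0 0 * g s 1 1 * g s 2 2)
      + rho (g s) (f s) / 2 - tr (g s) (stress (g s) (f s)) / 6)
        * Real.exp (3 * (tau τ₀ t₀ g k s - τ₀)) := mul_nonneg (by linarith) (Real.exp_pos _).le
    linarith)
  have := hmono ⟨le_rfl, ht.1⟩ ⟨ht.1, le_rfl⟩ ht.1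
  simpa [tau] using this

theorem IsSolution.hubble_pos (h : IsSolution structVII0 t₀ T g k f)
    (hr : IsReflectionSymmetric t₀ T g k f) {δ : ℝ} (hδ : 0 < δ)
    (hinit : ∀ p, δ ≤ momSq (g t₀) p → f t₀ p = 0) (hH : 0 < hubble (g t₀) (k t₀))
    {t : ℝ} (ht : t ∈ timeInterval t₀ T) : 0 < hubble (g t) (k t) :=
  pos_of_mul_pos_left (hH.trans_le (h.hubble_mul_exp_ge hr hδ hinit 0 ht)) (Real.exp_pos _).le

theorem IsSolution.tendsto_tau (h : IsSolution structVII0 t₀ ⊤ g k f)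
    (hr : IsReflectionSymmetric t₀ ⊤ g k f) {δ : ℝ} (hδ : 0 < δ)
    (hinit : ∀ p, δ ≤ momSq (g t₀) p → f t₀ p = 0) (hH : 0 < hubble (g t₀) (k t₀)) (τ₀ : ℝ) :
    Tendsto (tau τ₀ t₀ g k) atTop atTop := by
  set H₀ := hubble (g t₀) (k t₀) with hH₀
  -- The derivative of `e^{3u}` is `3 H e^{3u} ≥ 3 H₀`, so `u` grows at least logarithmically in
  -- `t`.
  have key : ∀ t, t₀ ≤ t → 1 + 3 * H₀ * (t - t₀) ≤ Real.exp (3 * (tau τ₀ t₀ g k t - τ₀)) := by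
    intro t ht
    have hmem : t ∈ timeInterval t₀ ⊤ := ⟨ht, EReal.coe_lt_top t⟩
    have hmono := monotoneOn_Icc_of_hasDerivWithinAt (a := t₀) (b := t) (fun s hs =>
      (((h.hasDerivWithinAt_tau hr τ₀ hmem hs).const_mul 3).exp).sub
        (((hasDerivWithinAt_id s (Icc t₀ t)).sub_const t₀).const_mul (3 * H₀))) (by
      intro s hs
      have := h.hubble_mul_exp_ge hr hδ hinit τ₀ (Icc_subset_timeInterval hmem hs)
      linarith)
    have := hmono ⟨le_rfl, ht⟩ ⟨ht, le_rfl⟩ ht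
    simp only [tau, Pi.sub_apply, intervalIntegral.integral_same, add_zero, sub_self, mul_zero,
      Real.exp_zero, id_eq, sub_zero] at this ⊢
    linarith
  have hlow : Tendsto (fun t => τ₀ + 1 / 3 * Real.log (1 + 3 * H₀ * (t - t₀))) atTop atTop := by
    refine tendsto_atTop_add_const_left _ _ (Tendsto.const_mul_atTop (by norm_num)
      (Real.tendsto_log_atTop.comp (tendsto_atTop_add_const_left _ _
        (Tendsto.const_mul_atTop (by positivity) ?_))))
    exact tendsto_atTop_add_const_right _ _ tendsto_id
  refine tendsto_atTop_mono' _ ?_ hlow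
  filter_upwards [eventually_ge_atTop t₀] with t ht
  have h1 : 0 < 1 + 3 * H₀ * (t - t₀) := by
    have := mul_nonneg hH.le (sub_nonneg.2 ht)
    linarith
  have h2 := Real.log_le_log h1 (key t ht)
  rw [Real.log_exp] at h2
  linarith

theorem abs_sigmaMinus_le_varX (g k : Mat3) : |sigmaMinus g k| ≤ varX g k :=
  Real.abs_le_sqrt (by linarith [sq_nonneg (Nminus g k)])

theorem sq_varX (g k : Mat3) : varX g k ^ 2 = sigmaMinus g k ^ 2 + Nminus g k ^ 2 := by
  rw [varX, Real.sq_sqrt (by positivity), add_comm]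

/-- With `√3 ≤ 2` the shear lowers each `2 k^i_i` by at most `6η H`; the constant `7` makes the
inequality strict, as the maximum principle demands. -/
theorem expRate_gt {g k : Mat3} (hg : g.IsDiag) (hpos : ∀ i, 0 < g i i) (hH : 0 < hubble g k)
    {η : ℝ} (hη : 0 < η) (hp : |sigmaPlus g k| ≤ η) (hX : varX g k ≤ η) (i : Fin 3) :
    (2 - 7 * η) * hubble g k < 2 * expRate g k i := by
  have h3 : √3 ≤ 2 := by rw [Real.sqrt_le_left (by norm_num)]; norm_num
  have hm := (abs_sigmaMinus_le_varX g k).trans hX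
  have hm3 : |√3 * sigmaMinus g k| ≤ 2 * η := by
    rw [abs_mul, abs_of_nonneg (Real.sqrt_nonneg 3)]
    exact mul_le_mul h3 hm (abs_nonneg _) (by norm_num)
  have hp' := abs_le.1 hp
  have hm' := abs_le.1 hm3
  have hHη := mul_pos hH hη
  fin_cases i
  · simp only [Fin.zero_eta, expRate_zero_eq hg hpos hH.ne']
    nlinarith
  · simp only [Fin.mk_one, expRate_one_eq hg hpos hH.ne']
    nlinarith
  · simp only [Fin.reduceFinMk, expRate_two_eq hg hpos hH.ne']
    nlinarith

theorem IsSolution.momSq_le_of_small (h : IsSolution structVII0 t₀ T g k f)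
    (hr : IsReflectionSymmetric t₀ T g k f) {δ : ℝ} (hδ : 0 < δ)
    (hinit : ∀ p, δ ≤ momSq (g t₀) p → f t₀ p = 0) (hH : 0 < hubble (g t₀) (k t₀)) (τ₀ : ℝ)
    {η : ℝ} (hη : 0 < η) {t : ℝ} (ht : t ∈ timeInterval t₀ T)
    (hp : ∀ s ∈ Icc t₀ t, |sigmaPlus (g s) (k s)| ≤ η)
    (hX : ∀ s ∈ Icc t₀ t, varX (g s) (k s) ≤ η) (p : Fin 3 → ℝ) (hf : f t p ≠ 0) :
    momSq (g t) p ≤ δ * Real.exp ((-2 + 7 * η) * (tau τ₀ t₀ g k t - τ₀)) := by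
  have hJ := Icc_subset_timeInterval ht
  have h1 := h.momSq_lt_of_ne_zero hr ht
    (fun s hs => (h.hasDerivWithinAt_tau hr τ₀ ht hs).const_mul (2 - 7 * η)) (by simp [tau])
    (fun s hs i => expRate_gt (hr.diag_g s (hJ hs)) (h.metric_pos (hJ hs))
      (h.hubble_pos hr hδ hinit hH (hJ hs)) hη (hp s hs) (hX s hs) i) hδ hinit hf
  have h2 : (-2 + 7 * η) * (tau τ₀ t₀ g k t - τ₀) = -((2 - 7 * η) * (tau τ₀ t₀ g k t - τ₀)) := by
    ring
  rw [h2, Real.exp_neg, ← div_eq_mul_inv, le_div_iff₀ (Real.exp_pos _)]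
  exact h1.le

/-- Each `S^i_i` (no summation) lies between `0` and `S`. -/
theorem abs_stress_anisotropy_plus_le {g k : Mat3} {F : (Fin 3 → ℝ) → ℝ} (hg : g.IsDiag)
    (hpos : ∀ i, 0 < g i i) (hF0 : ∀ p, 0 ≤ F p) :
    |(tr g (stress g F) / 3 - stress g F 0 0 / g 0 0) / 2 / hubble g k ^ 2|
      ≤ tr g (stress g F) / hubble g k ^ 2 / 3 := by
  have := fun i => div_nonneg (stress_diag_nonneg (g := g) hF0 i) (hpos i).le
  have h0 := this 0
  have h1 := this 1
  have h2 := this 2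
  have e := tr_eq_of_diag hg hpos (stress g F)
  rw [abs_div, abs_of_nonneg (sq_nonneg (hubble g k)), div_right_comm _ _ (3 : ℝ)]
  refine div_le_div_of_nonneg_right ?_ (sq_nonneg _)
  rw [abs_le]
  constructor <;> linarith

theorem abs_stress_anisotropy_minus_le {g k : Mat3} {F : (Fin 3 → ℝ) → ℝ} (hg : g.IsDiag)
    (hpos : ∀ i, 0 < g i i) (hF0 : ∀ p, 0 ≤ F p) :
    |(stress g F 1 1 / g 1 1 - stress g F 2 2 / g 2 2) / (2 * √3) / hubble g k ^ 2|
      ≤ tr g (stress g F) / hubble g k ^ 2 / 3 := by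
  have := fun i => div_nonneg (stress_diag_nonneg (g := g) hF0 i) (hpos i).le
  have h0 := this 0
  have h1 := this 1
  have h2 := this 2
  have e := tr_eq_of_diag hg hpos (stress g F)
  have h3 : 3 / 2 ≤ √3 := Real.le_sqrt_of_sq_le (by norm_num)
  rw [abs_div, abs_of_nonneg (sq_nonneg (hubble g k)), div_right_comm _ _ (3 : ℝ)]
  refine div_le_div_of_nonneg_right ?_ (sq_nonneg _)
  rw [abs_div, abs_of_pos (show 0 < 2 * √3 by linarith)]
  refine div_le_div₀ (by linarith) ?_ (by norm_num) (by linarith)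
  rw [abs_le]
  constructor <;> linarith

/-- As long as the normalised variables are small, they define a small orbit of the reduced
system. -/
theorem IsSolution.isSmallOrbit (h : IsSolution structVII0 t₀ T g k f)
    (hr : IsReflectionSymmetric t₀ T g k f) {η : ℝ} (hη : 0 < η)
    (hinit : ∀ p, η ^ 4 ≤ momSq (g t₀) p → f t₀ p = 0) (hH : 0 < hubble (g t₀) (k t₀))
    (hp0 : |sigmaPlus (g t₀) (k t₀)| ≤ η ^ 4) (hX0 : varX (g t₀) (k t₀) ≤ η ^ 4)
    (hM0 : varM (g t₀) (k t₀) ≤ η ^ 4) (τ₀ : ℝ)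
    {t₁ : ℝ} (ht₁ : t₁ ∈ timeInterval t₀ T)
    (hp : ∀ s ∈ Icc t₀ t₁, |sigmaPlus (g s) (k s)| ≤ η)
    (hX : ∀ s ∈ Icc t₀ t₁, varX (g s) (k s) ≤ η)
    (hM : ∀ s ∈ Icc t₀ t₁, varM (g s) (k s) ≤ η) :
    IsSmallOrbit η t₀ t₁ (fun t => tau τ₀ t₀ g k t - τ₀) (fun t => hubble (g t) (k t))
      (fun t => sigmaPlus (g t) (k t)) (fun t => sigmaMinus (g t) (k t))
      (fun t => Nminus (g t) (k t)) (fun t => varM (g t) (k t))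
      (fun t => tr (g t) (stress (g t) (f t)) / hubble (g t) (k t) ^ 2)
      (fun t => (tr (g t) (stress (g t) (f t)) / 3 - stress (g t) (f t) 0 0 / g t 0 0)
          / 2 / hubble (g t) (k t) ^ 2)
      (fun t => (stress (g t) (f t) 1 1 / g t 1 1 - stress (g t) (f t) 2 2 / g t 2 2)
          / (2 * √3) / hubble (g t) (k t) ^ 2) := by
  have hη4 : 0 < η ^ 4 := by positivity
  have hJ := Icc_subset_timeInterval ht₁
  have hpos : ∀ t ∈ Icc t₀ t₁, 0 < hubble (g t) (k t) := fun t ht =>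
    h.hubble_pos hr hη4 hinit hH (hJ ht)
  exact
  { u_zero := by simp [tau]
    H_pos := hpos
    deriv_u := fun t ht => h.hasDerivWithinAt_tau hr τ₀ ht₁ ht
    deriv_p := fun t ht => (h.hasDerivWithinAt_sigmaPlus hr (hJ ht) (hpos t ht).ne').mono hJ
    deriv_m := fun t ht => (h.hasDerivWithinAt_sigmaMinus hr (hJ ht) (hpos t ht).ne').mono hJ
    deriv_n := fun t ht => (h.hasDerivWithinAt_Nminus hr (hJ ht) (hpos t ht).ne').mono hJ
    deriv_M := fun t ht => (h.hasDerivWithinAt_varM hr (hJ ht) (hpos t ht)).mono hJ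
    abs_κ_le := fun t ht => abs_stress_anisotropy_plus_le (hr.diag_g t (hJ ht))
      (h.metric_pos (hJ ht)) (h.nonneg_f t (hJ ht))
    abs_σ_le := fun t ht => abs_stress_anisotropy_minus_le (hr.diag_g t (hJ ht))
      (h.metric_pos (hJ ht)) (h.nonneg_f t (hJ ht))
    s_le := fun t ht => by
      have hA0 : 0 ≤ η ^ 4 * Real.exp ((-2 + 7 * η) * (tau τ₀ t₀ g k t - τ₀)) := by positivity
      have hS := tr_stress_le_mul_rho (hr.diag_g t (hJ ht)) (h.metric_pos (hJ ht))
        (h.continuous_distribution (hJ ht)) (h.nonneg_f t (hJ ht)) hA0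
        (h.momSq_le_of_small hr hη4 hinit hH τ₀ hη (hJ ht)
          (fun s hs => hp s ⟨hs.1, hs.2.trans ht.2⟩) (fun s hs => hX s ⟨hs.1, hs.2.trans ht.2⟩))
      -- The Hamiltonian constraint bounds the matter density by its isotropic, flat value, which is
      -- the source of the factor `3` in `s_le`.
      have hρ : rho (g t) (f t) ≤ 3 * hubble (g t) (k t) ^ 2 := by
        rw [h.rho_eq hr (hJ ht) (hpos t ht).ne']
        have h2 := sq_nonneg (hubble (g t) (k t))
        nlinarith [mul_nonneg h2 (sq_nonneg (sigmaPlus (g t) (k t))),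
          mul_nonneg h2 (sq_nonneg (sigmaMinus (g t) (k t))),
          mul_nonneg h2 (sq_nonneg (Nminus (g t) (k t)))]
      rw [div_le_iff₀ (pow_pos (hpos t ht) 2)]
      have := mul_le_mul_of_nonneg_left hρ hA0
      linarith
    abs_p_le := hp
    amplitude_le := fun t ht => by
      rw [← sq_varX]
      exact pow_le_pow_left₀ (Real.sqrt_nonneg _) (hX t ht) 2
    M_pos := fun t ht => varM_pos (h.metric_pos (hJ ht)) (hpos t ht)
    M_le := hM
    abs_p_init := hp0
    amplitude_init := by
      rw [← sq_varX]
      exact pow_le_pow_left₀ (Real.sqrt_nonneg _) hX0 2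
    M_init := hM0 }

theorem varX_le_of_amplitude_le {g k : Mat3} {η c u : ℝ} (hη : 0 < η)
    (h : sigmaMinus g k ^ 2 + Nminus g k ^ 2 ≤ η ^ 6 * Real.exp (-(c * u))) :
    varX g k ≤ η ^ 3 * Real.exp (-(c / 2 * u)) := by
  refine abs_le_of_sq_le_sq' ?_ (by positivity) |>.2
  rw [sq_varX, mul_pow, ← Real.exp_nat_mul]
  refine h.trans (le_of_eq ?_)
  congr 1
  · ring
  · congr 1; push_cast; ring

/-- The bootstrap argument: the normalised variables remain small. -/
theorem IsSolution.small_of_small_init (h : IsSolution structVII0 t₀ T g k f)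
    (hr : IsReflectionSymmetric t₀ T g k f) {η : ℝ} (hη : 0 < η) (hη1 : η ≤ 1 / 100)
    (hinit : ∀ p, η ^ 4 ≤ momSq (g t₀) p → f t₀ p = 0) (hH : 0 < hubble (g t₀) (k t₀))
    (hp0 : |sigmaPlus (g t₀) (k t₀)| ≤ η ^ 4) (hX0 : varX (g t₀) (k t₀) ≤ η ^ 4)
    (hM0 : varM (g t₀) (k t₀) ≤ η ^ 4) {t : ℝ} (ht : t ∈ timeInterval t₀ T) :
    |sigmaPlus (g t) (k t)| < η ∧ varX (g t) (k t) < η ∧ varM (g t) (k t) < η := by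
  have hη4 : 0 < η ^ 4 := by positivity
  have hη2 : η ^ 2 < 1 / 4 := by nlinarith
  have hη3 : η ^ 3 < η := by nlinarith
  have hη4' : 4 * η ^ 4 < η := by nlinarith
  have hJ := Icc_subset_timeInterval ht
  have hpos : ∀ s ∈ Icc t₀ t, 0 < hubble (g s) (k s) := fun s hs =>
    h.hubble_pos hr hη4 hinit hH (hJ hs)
  have hpc : ContinuousOn (fun s => sigmaPlus (g s) (k s)) (Icc t₀ t) := fun s hs =>
    ((h.hasDerivWithinAt_sigmaPlus hr (hJ hs) (hpos s hs).ne').mono hJ).continuousWithinAt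
  have hmc : ContinuousOn (fun s => sigmaMinus (g s) (k s)) (Icc t₀ t) := fun s hs =>
    ((h.hasDerivWithinAt_sigmaMinus hr (hJ hs) (hpos s hs).ne').mono hJ).continuousWithinAt
  have hnc : ContinuousOn (fun s => Nminus (g s) (k s)) (Icc t₀ t) := fun s hs =>
    ((h.hasDerivWithinAt_Nminus hr (hJ hs) (hpos s hs).ne').mono hJ).continuousWithinAt
  have hMc : ContinuousOn (fun s => varM (g s) (k s)) (Icc t₀ t) := fun s hs =>
    ((h.hasDerivWithinAt_varM hr (hJ hs) (hpos s hs)).mono hJ).continuousWithinAt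
  have hXc : ContinuousOn (fun s => varX (g s) (k s)) (Icc t₀ t) := ((hnc.pow 2).add (hmc.pow 2)).sqrt
  have hφc : ContinuousOn (fun s => max |sigmaPlus (g s) (k s)|
    (max (varX (g s) (k s)) (varM (g s) (k s)))) (Icc t₀ t) := ContinuousOn.sup hpc.abs (ContinuousOn.sup hXc hMc)
  have hall := forall_lt_of_continuousOn_of_improvement hφc (η := η)
    (max_lt (by linarith) (max_lt (by linarith) (by linarith))) (by
      intro s hs hle
      have ho := h.isSmallOrbit hr hη hinit hH hp0 hX0 hM0 0 (hJ hs)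
        (fun r hr => (le_max_left _ _).trans (hle r hr))
        (fun r hr => ((le_max_left _ _).trans (le_max_right _ _)).trans (hle r hr))
        (fun r hr => ((le_max_right _ _).trans (le_max_right _ _)).trans (hle r hr))
      have hs' : s ∈ Icc t₀ s := ⟨hs.1, le_rfl⟩
      have e1 := ho.p_decay hη hη1 hs'
      have e2 := varX_le_of_amplitude_le hη (ho.amplitude_decay hη hη1 hs')
      have e3 := ho.M_decay hη hη1 hs'
      have e4 := ho.exp_le_one (c := -(1 - 16 * η)) (by linarith) hs'
      have e5 := ho.exp_le_one (c := -((1 - 16 * η) / 2)) (by linarith) hs'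
      have e6 := ho.exp_le_one (c := -(1 / 2) + 4 * η) (by linarith) hs'
      simp only [neg_mul] at e4 e5
      have hη3' : 0 < η ^ 3 := by positivity
      -- The recovered bounds `4 η ^ 4`, `η ^ 3` and `η ^ 4` all lie strictly below `η`.
      refine max_lt (e1.trans_lt ?_) (max_lt (e2.trans_lt ?_) (e3.trans_lt ?_)) <;> nlinarith)
  have := hall t ⟨ht.1, le_rfl⟩
  exact ⟨(le_max_left _ _).trans_lt this,
    ((le_max_left _ _).trans (le_max_right _ _)).trans_lt this,
    ((le_max_right _ _).trans (le_max_right _ _)).trans_lt this⟩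

end Global

theorem mul_exp_le_mul_exp {a b c d u : ℝ} (hab : a ≤ b) (hb : 0 ≤ b) (hcd : c ≤ d)
    (hu : 0 ≤ u) : a * Real.exp (c * u) ≤ b * Real.exp (d * u) :=
  mul_le_mul hab (Real.exp_le_exp.2 (mul_le_mul_of_nonneg_right hcd hu)) (Real.exp_pos _).le hb

end BianchiEV

/-! ### The proposition. -/

theorem mainTheorem2 (ε : ℝ) (hε : 0 < ε) :
    ∃ δ : ℝ, 0 < δ ∧
      ∀ (t₀ τ₀ : ℝ) (T : EReal) (g k : ℝ → BianchiEV.Mat3) (f : ℝ → (Fin 3 → ℝ) → ℝ),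
        (t₀ : EReal) < T →
        BianchiEV.IsSolution BianchiEV.structVII0 t₀ T g k f →
        BianchiEV.IsReflectionSymmetric t₀ T g k f →
        0 < BianchiEV.hubble (g t₀) (k t₀) →
        BianchiEV.momSup (g t₀) (f t₀) < ENNReal.ofReal δ →
        |BianchiEV.sigmaPlus (g t₀) (k t₀)| < δ →
        BianchiEV.varX (g t₀) (k t₀) < δ →
        BianchiEV.varM (g t₀) (k t₀) < δ →
        (∀ t ∈ BianchiEV.timeInterval t₀ T,
          0 < BianchiEV.hubble (g t) (k t) ∧
          0 < BianchiEV.rho (g t) (f t) ∧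
          |BianchiEV.sigmaPlus (g t) (k t)|
            ≤ ε * Real.exp ((-1 + ε) * (BianchiEV.tau τ₀ t₀ g k t - τ₀)) ∧
          BianchiEV.varX (g t) (k t)
            ≤ ε * Real.exp ((-(1 / 2) + ε) * (BianchiEV.tau τ₀ t₀ g k t - τ₀)) ∧
          BianchiEV.varM (g t) (k t)
            ≤ ε * Real.exp ((-(1 / 2) + ε) * (BianchiEV.tau τ₀ t₀ g k t - τ₀)) ∧
          BianchiEV.tr (g t) (BianchiEV.stress (g t) (f t)) / BianchiEV.rho (g t) (f t)
            ≤ ε * Real.exp ((-2 + ε) * (BianchiEV.tau τ₀ t₀ g k t - τ₀))) ∧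
        (T = ⊤ → Tendsto (BianchiEV.tau τ₀ t₀ g k) atTop atTop) := by
  -- The worst loss among the four rates is `16η`, for `Σ₊`; the cap `1/100` is the smallness
  -- assumed in the pointwise estimates.
  set η := min (ε / 16) (1 / 100) with hηdef
  have hη : 0 < η := lt_min (by positivity) (by norm_num)
  have hη1 : η ≤ 1 / 100 := min_le_right _ _
  have hηε : 16 * η ≤ ε := by
    have := min_le_left (ε / 16) (1 / 100 : ℝ)
    rw [← hηdef] at this
    linarith
  have hη2 : η ^ 2 ≤ 1 := by nlinarith
  have hη3 : η ^ 3 ≤ η := by nlinarith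
  have hη4 : η ^ 4 ≤ η := by nlinarith
  have hδ : 0 < η ^ 4 := by positivity
  refine ⟨η ^ 4, hδ, fun t₀ τ₀ T g k f _ h hr hH hP hp0 hX0 hM0 => ⟨fun t ht => ?_, ?_⟩⟩
  · have hinit := BianchiEV.eq_zero_of_le_momSq hP
    have hsmall := fun s (hs : s ∈ Icc t₀ t) => h.small_of_small_init hr hη hη1 hinit hH hp0.le
      hX0.le hM0.le (BianchiEV.Icc_subset_timeInterval ht hs)
    have ho := h.isSmallOrbit hr hη hinit hH hp0.le hX0.le hM0.le τ₀ ht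
      (fun s hs => (hsmall s hs).1.le) (fun s hs => (hsmall s hs).2.1.le)
      (fun s hs => (hsmall s hs).2.2.le)
    have ht' : t ∈ Icc t₀ t := ⟨ht.1, le_rfl⟩
    have hHt := h.hubble_pos hr hδ hinit hH ht
    have hu := ho.u_nonneg ht'
    have hρ : 0 < BianchiEV.rho (g t) (f t) := by
      -- By the constraint, `ρ / (3 H²)` is `1` minus a quantity quadratic in the small variables.
      rw [h.rho_eq hr ht hHt.ne']
      have h1 := ho.amplitude_le t ht'
      have h2 : BianchiEV.sigmaPlus (g t) (k t) ^ 2 ≤ η ^ 2 :=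
        sq_le_sq' (neg_le_of_abs_le (ho.abs_p_le t ht')) (le_of_abs_le (ho.abs_p_le t ht'))
      have h3 : η ^ 2 ≤ 1 / 100 := by nlinarith
      have h4 : 0 < 1 - BianchiEV.sigmaPlus (g t) (k t) ^ 2 - BianchiEV.sigmaMinus (g t) (k t) ^ 2
        - BianchiEV.Nminus (g t) (k t) ^ 2 := by linarith
      positivity
    refine ⟨hHt, hρ, ?_, ?_, ?_, ?_⟩
    · have h1 := ho.p_decay hη hη1 ht'
      rw [← neg_mul] at h1
      exact h1.trans (BianchiEV.mul_exp_le_mul_exp (by linarith) hε.le (by linarith) hu)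
    · have h1 := BianchiEV.varX_le_of_amplitude_le hη (ho.amplitude_decay hη hη1 ht')
      rw [← neg_mul] at h1
      exact h1.trans (BianchiEV.mul_exp_le_mul_exp (by linarith) hε.le (by linarith) hu)
    · exact (ho.M_decay hη hη1 ht').trans
        (BianchiEV.mul_exp_le_mul_exp (by linarith) hε.le (by linarith) hu)
    · rw [div_le_iff₀ hρ]
      have hmom := h.momSq_le_of_small hr hδ hinit hH τ₀ hη ht ho.abs_p_le
        (fun s hs => (hsmall s hs).2.1.le)
      have h1 := BianchiEV.tr_stress_le_mul_rho (hr.diag_g t ht) (h.metric_pos ht)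
        (h.continuous_distribution ht) (h.nonneg_f t ht) (by positivity) hmom
      exact h1.trans (mul_le_mul_of_nonneg_right
        (BianchiEV.mul_exp_le_mul_exp (by linarith) hε.le (by linarith) hu) hρ.le)
  · rintro rfl
    exact h.tendsto_tau hr hδ (BianchiEV.eq_zero_of_le_momSq hP) hH τ₀
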